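/- Let $A$ be a commutative ring. For $i=1,2$ let $X_i$ be a Noetherian affine $A$-scheme, $Z_i\subset X_i$ a closed subscheme and $g_i:Z_i\to V_i$ a finite surjective morphism of $A$-schemes, and let $Y_i$ be the (universal) push-out of $X_i\leftarrow Z_i\stackrel{g_i}{\to} V_i$, that is, an $A$-scheme together with morphisms $X_i\to Y_i$ and $V_i\to Y_i$ that make it a push-out in the category of $A$-schemes. Let $$ \begin{array}{ccccc} V_1 & \stackrel{g_1}{\leftarrow} & Z_1 & \hookrightarrow & X_1\\ \downarrow && \downarrow && \downarrow \\ V_2 & \stackrel{g_2}{\leftarrow} & Z_2 & \hookrightarrow & X_2 \end{array} $$ be a commutative diagram of $A$-schemes in which both squares are fiber products, and let $Y_1\to Y_2$ be the induced morphism of push-outs. 1. If the three vertical morphisms are flat, then $Y_1\to Y_2$ is flat. 2. If the three vertical morphisms are smooth, then $Y_1\to Y_2$ is smooth. -/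

import Mathlib

open CategoryTheory AlgebraicGeometry

universe u

/-- The morphism `Y₁ ⟶ Y₂` of push-outs of `X₁ ⟵ Z₁ ⟶ V₁` and `X₂ ⟵ Z₂ ⟶ V₂` that is induced
by a morphism of spans `(x, z, v)`: the unique one compatible with `x` and `v`. -/
noncomputable def inducedPushoutMap {C : Type*} [Category C]
    {X₁ Z₁ V₁ Y₁ X₂ Z₂ V₂ Y₂ : C}
    {i₁ : Z₁ ⟶ X₁} {g₁ : Z₁ ⟶ V₁} {p₁ : X₁ ⟶ Y₁} {j₁ : V₁ ⟶ Y₁}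
    {i₂ : Z₂ ⟶ X₂} {g₂ : Z₂ ⟶ V₂} {p₂ : X₂ ⟶ Y₂} {j₂ : V₂ ⟶ Y₂}
    (h₁ : IsPushout i₁ g₁ p₁ j₁) (h₂ : IsPushout i₂ g₂ p₂ j₂)
    {x : X₁ ⟶ X₂} {z : Z₁ ⟶ Z₂} {v : V₁ ⟶ V₂}
    (hx : i₁ ≫ x = z ≫ i₂) (hv : g₁ ≫ v = z ≫ g₂) : Y₁ ⟶ Y₂ :=
  h₁.desc (x ≫ p₂) (v ≫ j₂) (by
    rw [← Category.assoc, hx, Category.assoc, h₂.w, ← Category.assoc, ← hv, Category.assoc])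

/-!
Locally on the push-out `Y` of `X ← Z → V`, with `Z → X` a closed immersion and `Z → V` finite, the
situation is affine: `X = Spec A`, `V = Spec B`, `Z = Spec C` with `A → C` surjective, and
`Y = Spec R` with `R = A ×_C B`. Such a cartesian square of rings is called a Milnor square here.

*Reduction to rings.* The push-out `P` in the category of locally ringed spaces is explicit: its
space is the topological push-out, and its sections over `O` are the pairs of sections over the
preimages of `O` in `X` and `V` that agree on `Z`
(`AlgebraicGeometry.LocallyRingedSpace.isPullback_c_app`). If both preimages are affine, then `O` is
affine: `O → Spec R` is continuous, bijective and closed, because `A` is integral over `R`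
(`IsMilnorSquare.isHomeomorph_of_comp_eq_comap`), and localization commutes with fibre products, so
the structure sheaves agree
(`AlgebraicGeometry.LocallyRingedSpace.isIso_toΓSpec_restrict`). Such `O` cover `P`: prime avoidance
on `X` provides affine open subsets `W ⊆ X` and `U ⊆ V` with the same preimage in `Z`, around every
point of `V`
(`AlgebraicGeometry.LocallyRingedSpace.exists_isAffineOpen_of_finite`). Hence `P` is a scheme, and it
is the given push-out `Y` (`AlgebraicGeometry.Scheme.isPushout_toLRSHom`). A cartesian morphism of
spans therefore becomes, locally, a morphism from a Milnor square `R, A, B, C` to a cartesian square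
`S, A', B', C'` in which `C'` is the base change of both `A'` and `B'`
(`AlgebraicGeometry.Scheme.isMilnorMap_appLE`).

*Modules over a Milnor square.* If an `R`-module `M` is glued from an `A`-module and a `B`-module
along a common base change to `C`, then it recovers both by base change
(`IsGluedModule.isBaseChange_fst`, `IsGluedModule.isBaseChange_snd`). In particular `A ⊗ S = A'` and
`B ⊗ S = B'`. It remains to descend flatness and smoothness of an `R`-algebra `S` from its base
changes to `A` and `B`. Flatness is `IsMilnorSquare.flat`. For smoothness, a module that
vanishes after base change to `A` and to `B` is zero, which gives finite presentation, and every
residue field of `R` receives a map from `A` or from `B`, so that the fibres of the flat algebra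
`S` are smooth (`IsMilnorSquare.smooth`).
-/

set_option linter.unusedSectionVars false



/-! ### Modules glued over a Milnor square -/

section Milnor

open TensorProduct

/-- If `A → C` is surjective with kernel `I`, then the kernel of the base change `N → N'` of an
`A`-module to `C` is contained in `I N`. -/
lemma IsBaseChange.surjective_and_ker_le {A C N N' : Type*} [CommRing A] [CommRing C] [Algebra A C]
    [AddCommGroup N] [AddCommGroup N'] [Module A N] [Module A N'] [Module C N']
    [IsScalarTower A C N'] {f : N →ₗ[A] N'} (hf : IsBaseChange C f)
    (hs : Function.Surjective (algebraMap A C)) :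
    Function.Surjective f ∧
      LinearMap.ker f ≤ RingHom.ker (algebraMap A C) • (⊤ : Submodule A N) := by
  constructor
  · intro x
    induction x using hf.inductionOn with
    | zero => exact ⟨0, map_zero _⟩
    | tmul m => exact ⟨m, rfl⟩
    | smul c n hn =>
      obtain ⟨a, rfl⟩ := hs c
      obtain ⟨y, rfl⟩ := hn
      exact ⟨a • y, by simp⟩
    | add x y hx hy =>
      obtain ⟨x, rfl⟩ := hx
      obtain ⟨y, rfl⟩ := hy
      exact ⟨x + y, map_add _ _ _⟩
  · -- `N / I N` is a `C`-module, so that `N → N / I N` factors through `f`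
    set I := RingHom.ker (algebraMap A C)
    let Q := N ⧸ (I • (⊤ : Submodule A N))
    let e : (A ⧸ I) ≃+* C := RingHom.quotientKerEquivOfSurjective hs
    let : Module C Q := Module.compHom Q e.symm.toRingHom
    have key : ∀ (a : A) (q : Q), algebraMap A C a • q = a • q := by
      intro a q
      change e.symm (algebraMap A C a) • q = a • q
      have : e.symm (algebraMap A C a) = Ideal.Quotient.mk I a := by
        rw [RingEquiv.symm_apply_eq]; rfl
      rw [this]
      rfl
    have : IsScalarTower A C Q := ⟨fun a c q => by
      obtain ⟨a', rfl⟩ := hs c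
      rw [Algebra.smul_def, ← map_mul, key, key, mul_smul]⟩
    intro x hx
    have := hf.lift_eq (Submodule.mkQ (I • (⊤ : Submodule A N))) x
    rw [LinearMap.mem_ker.mp hx, map_zero] at this
    exact (Submodule.Quotient.mk_eq_zero _).mp this.symm

/-- The commutative square of rings `R → A → C`, `R → B → C` is a *Milnor square*: it is cartesian
and `A → C` is surjective. -/
structure IsMilnorSquare (R A B C : Type*) [CommRing R] [CommRing A] [CommRing B] [CommRing C]
    [Algebra R A] [Algebra R B] [Algebra A C] [Algebra B C] : Prop where
  surjective : Function.Surjective (algebraMap A C)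
  eq_zero : ∀ r : R, algebraMap R A r = 0 → algebraMap R B r = 0 → r = 0
  exists_lift : ∀ (a : A) (b : B), algebraMap A C a = algebraMap B C b →
    ∃ r : R, algebraMap R A r = a ∧ algebraMap R B r = b

/-- A module glued from an `A`-module and a `B`-module along a `C`-module: the square
`M → A₁ → C₁`, `M → B₁ → C₁` is cartesian and `C₁` is the base change to `C` of `A₁` and of `B₁`. -/
structure IsGluedModule {R : Type*} (A B C : Type*) [CommRing R] [CommRing A] [CommRing B]
    [CommRing C] [Algebra A C] [Algebra B C]
    {M A₁ B₁ C₁ : Type*} [AddCommGroup M] [AddCommGroup A₁] [AddCommGroup B₁]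
    [AddCommGroup C₁] [Module R M] [Module R A₁] [Module R B₁]
    [Module A A₁] [Module B B₁] [Module A C₁] [Module B C₁] [Module C C₁]
    [IsScalarTower A C C₁] [IsScalarTower B C C₁]
    (mA : M →ₗ[R] A₁) (mB : M →ₗ[R] B₁) (γA : A₁ →ₗ[A] C₁) (γB : B₁ →ₗ[B] C₁) : Prop where
  w : ∀ m, γA (mA m) = γB (mB m)
  eq_zero : ∀ m, mA m = 0 → mB m = 0 → m = 0
  exists_lift : ∀ a b, γA a = γB b → ∃ m, mA m = a ∧ mB m = b
  isBaseChange_left : IsBaseChange C γA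
  isBaseChange_right : IsBaseChange C γB

variable {R A B C : Type*} [CommRing R] [CommRing A] [CommRing B] [CommRing C]
  [Algebra R A] [Algebra R B] [Algebra R C] [Algebra A C] [Algebra B C]
  [IsScalarTower R A C] [IsScalarTower R B C]

namespace IsMilnorSquare

omit [Algebra R C] [IsScalarTower R A C] [IsScalarTower R B C] in
lemma surjective_right (h : IsMilnorSquare R A B C) : Function.Surjective (algebraMap R B) := by
  intro b
  obtain ⟨a, ha⟩ := h.surjective (algebraMap B C b)
  obtain ⟨r, -, hr⟩ := h.exists_lift a b ha
  exact ⟨r, hr⟩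

omit [Algebra R C] [IsScalarTower R A C] [IsScalarTower R B C] in
/-- The kernel of `A → C` is an ideal of `R`: it is the kernel of `R → B`. -/
lemma exists_lift_of_mem_ker (h : IsMilnorSquare R A B C) {a : A}
    (ha : a ∈ RingHom.ker (algebraMap A C)) :
    ∃ r : R, algebraMap R A r = a ∧ algebraMap R B r = 0 :=
  h.exists_lift a 0 (by rw [(RingHom.mem_ker).mp ha, map_zero])

end IsMilnorSquare

namespace IsGluedModule

variable {M A₁ B₁ C₁ : Type*} [AddCommGroup M] [AddCommGroup A₁] [AddCommGroup B₁]
  [AddCommGroup C₁] [Module R M] [Module R A₁] [Module R B₁] [Module R C₁]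
  [Module A A₁] [Module B B₁] [Module A C₁] [Module B C₁] [Module C C₁]
  [IsScalarTower R A A₁] [IsScalarTower R B B₁] [IsScalarTower R A C₁] [IsScalarTower R B C₁]
  [IsScalarTower A C C₁] [IsScalarTower B C C₁] [IsScalarTower R C C₁]
  {mA : M →ₗ[R] A₁} {mB : M →ₗ[R] B₁} {γA : A₁ →ₗ[A] C₁} {γB : B₁ →ₗ[B] C₁}

include mA mB γA γB

lemma surjective_right (hM : IsGluedModule A B C mA mB γA γB) (h : IsMilnorSquare R A B C) :
    Function.Surjective mB := by
  intro b
  obtain ⟨a, ha⟩ := (hM.isBaseChange_left.surjective_and_ker_le h.surjective).1 (γB b)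
  obtain ⟨m, -, hm⟩ := hM.exists_lift a b ha
  exact ⟨m, hm⟩

lemma span_range_left (hM : IsGluedModule A B C mA mB γA γB) (h : IsMilnorSquare R A B C) :
    Submodule.span A (Set.range mA) = ⊤ := by
  obtain ⟨hs, hk⟩ := hM.isBaseChange_left.surjective_and_ker_le h.surjective
  have hker : LinearMap.ker γA ≤ Submodule.span A (Set.range mA) := fun x hx => by
    obtain ⟨m, hm, -⟩ := hM.exists_lift x 0 (by rw [LinearMap.mem_ker.mp hx, map_zero])
    exact Submodule.subset_span ⟨m, hm⟩
  have key : ∀ c : C₁, ∃ x ∈ Submodule.span A (Set.range mA), γA x = c := by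
    intro c
    induction c using hM.isBaseChange_right.inductionOn with
    | zero => exact ⟨0, zero_mem _, map_zero _⟩
    | tmul b =>
      obtain ⟨m, rfl⟩ := hM.surjective_right h b
      exact ⟨mA m, Submodule.subset_span ⟨m, rfl⟩, hM.w m⟩
    | smul c n hn =>
      obtain ⟨a, rfl⟩ := h.surjective c
      obtain ⟨x, hx, rfl⟩ := hn
      exact ⟨a • x, Submodule.smul_mem _ _ hx, by simp⟩
    | add x y hx hy =>
      obtain ⟨x, hx, rfl⟩ := hx
      obtain ⟨y, hy, rfl⟩ := hy
      exact ⟨x + y, add_mem hx hy, map_add _ _ _⟩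
  rw [eq_top_iff]
  intro x _
  obtain ⟨y, hy, hxy⟩ := key (γA x)
  have := add_mem (hker (x := x - y) (by simp [hxy])) hy
  simpa using this

lemma ker_right_le (hM : IsGluedModule A B C mA mB γA γB) (h : IsMilnorSquare R A B C) :
    LinearMap.ker mB ≤ RingHom.ker (algebraMap R B) • (⊤ : Submodule R M) := by
  obtain ⟨hs, hk⟩ := hM.isBaseChange_left.surjective_and_ker_le h.surjective
  set I := RingHom.ker (algebraMap R B)
  have hI : ∀ m ∈ I • (⊤ : Submodule R M), mB m = 0 := by
    intro m hm
    refine Submodule.smul_induction_on hm (fun r hr n _ => ?_) fun x y hx hy => ?_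
    · rw [map_smul, ← algebraMap_smul B, RingHom.mem_ker.mp hr, zero_smul]
    · rw [map_add, hx, hy, add_zero]
  have key : ∀ x ∈ RingHom.ker (algebraMap A C) • (⊤ : Submodule A A₁),
      ∃ m ∈ I • (⊤ : Submodule R M), mA m = x := by
    intro x hx
    refine Submodule.smul_induction_on hx (fun i hi n _ => ?_) fun x y hx hy => ?_
    · have hn : n ∈ Submodule.span A (Set.range mA) := by rw [hM.span_range_left h]; trivial
      induction hn using Submodule.span_induction generalizing i with
      | mem x hx =>
        obtain ⟨m, rfl⟩ := hx
        obtain ⟨r, rfl, hr⟩ := h.exists_lift_of_mem_ker hi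
        exact ⟨r • m, Submodule.smul_mem_smul hr trivial, by simp⟩
      | zero => exact ⟨0, zero_mem _, by simp⟩
      | add x y _ _ hx hy =>
        obtain ⟨m, hm, hx⟩ := hx i hi trivial
        obtain ⟨m', hm', hy⟩ := hy i hi trivial
        exact ⟨m + m', add_mem hm hm', by rw [map_add, hx, hy, smul_add]⟩
      | smul a x _ hx =>
        obtain ⟨m, hm, hx⟩ := hx (i * a) (Ideal.mul_mem_right _ _ hi) trivial
        exact ⟨m, hm, by rw [hx, mul_smul]⟩
    · obtain ⟨m, hm, rfl⟩ := hx
      obtain ⟨m', hm', rfl⟩ := hy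
      exact ⟨m + m', add_mem hm hm', map_add _ _ _⟩
  intro m hm
  obtain ⟨m', hm', he⟩ := key (mA m) (hk (by
    rw [LinearMap.mem_ker, hM.w, LinearMap.mem_ker.mp hm, map_zero]))
  have : m - m' = 0 := hM.eq_zero _ (by rw [map_sub, he, sub_self])
    (by rw [map_sub, hI m' hm', LinearMap.mem_ker.mp hm, sub_self])
  rwa [sub_eq_zero.mp this]

/-- The second component of a glued module is its base change. -/
lemma isBaseChange_snd (hM : IsGluedModule A B C mA mB γA γB) (h : IsMilnorSquare R A B C) :
    IsBaseChange B mB := by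
  have hone : ∀ t : B ⊗[R] M, ∃ m, (1 : B) ⊗ₜ[R] m = t := by
    intro t
    induction t using TensorProduct.induction_on with
    | zero => exact ⟨0, tmul_zero _ _⟩
    | tmul b m =>
      obtain ⟨r, rfl⟩ := h.surjective_right b
      exact ⟨r • m, by rw [tmul_smul, smul_tmul', Algebra.smul_def, mul_one]⟩
    | add x y hx hy =>
      obtain ⟨m, rfl⟩ := hx
      obtain ⟨n, rfl⟩ := hy
      exact ⟨m + n, tmul_add _ _ _⟩
  constructor
  · rw [injective_iff_map_eq_zero]
    intro t ht
    obtain ⟨m, rfl⟩ := hone t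
    have hm : mB m = 0 := by simpa using ht
    refine Submodule.smul_induction_on (hM.ker_right_le h hm) (fun r hr n _ => ?_)
      fun x y hx hy => ?_
    · rw [tmul_smul, smul_tmul', Algebra.smul_def, RingHom.mem_ker.mp hr, zero_mul, zero_tmul]
    · rw [tmul_add, hx, hy, add_zero]
  · intro x
    obtain ⟨m, rfl⟩ := hM.surjective_right h x
    exact ⟨1 ⊗ₜ m, by simp⟩

/-- The first component of a glued module is its base change. -/
lemma isBaseChange_fst (hM : IsGluedModule A B C mA mB γA γB) (h : IsMilnorSquare R A B C) :
    IsBaseChange A mA := by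
  constructor
  · rw [injective_iff_map_eq_zero]
    intro t ht
    -- the `R`-linear sequence `R → A × B → C → 0` stays exact after tensoring with `M`
    let f : R →ₗ[R] A × B := (Algebra.linearMap R A).prod (Algebra.linearMap R B)
    let g : A × B →ₗ[R] C := (IsScalarTower.toAlgHom R A C).toLinearMap.coprod
      (-(IsScalarTower.toAlgHom R B C).toLinearMap)
    have hfg : Function.Exact f g := by
      rintro ⟨a, b⟩
      constructor
      · intro hab
        obtain ⟨r, hr⟩ := h.exists_lift a b (by simpa [g, ← sub_eq_add_neg, sub_eq_zero] using hab)
        exact ⟨r, Prod.ext hr.1 hr.2⟩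
      · rintro ⟨r, hr⟩
        rw [← hr]
        simp [f, g]
    have hg : Function.Surjective g := fun c => by
      obtain ⟨a, rfl⟩ := h.surjective c
      exact ⟨(a, 0), by simp [g]⟩
    have hex := rTensor_exact M hfg hg
    have hC : IsBaseChange C ((γB.restrictScalars R) ∘ₗ mB) :=
      (hM.isBaseChange_snd h).comp hM.isBaseChange_right
    have h0 : (g.rTensor M) ((LinearMap.inl R A B).rTensor M t) = 0 := by
      apply hC.equiv.injective
      rw [map_zero, ← LinearMap.comp_apply, ← LinearMap.rTensor_comp]
      have hgt : ∀ t : A ⊗[R] M, hC.equiv ((g ∘ₗ LinearMap.inl R A B).rTensor M t) =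
          γA ((TensorProduct.lift (((Algebra.linearMap A (Module.End A (M →ₗ[R] A₁))).flip
            mA).restrictScalars R)) t) := by
        intro t
        induction t using TensorProduct.induction_on with
        | zero => simp only [map_zero]
        | tmul a m =>
          simp [g, hC.equiv_tmul, ← hM.w]
        | add x y hx hy => simp only [map_add, hx, hy]
      rw [hgt]
      erw [ht]
      exact map_zero _
    obtain ⟨u, hu⟩ := (hex _).mp h0
    obtain ⟨m, rfl⟩ : ∃ m, (1 : R) ⊗ₜ[R] m = u :=
      ⟨TensorProduct.lid R M u, (TensorProduct.lid R M).injective (by simp)⟩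
    have h1 := congr((LinearMap.fst R A B).rTensor M $hu)
    have h2 := congr((LinearMap.snd R A B).rTensor M $hu)
    simp only [← LinearMap.comp_apply, ← LinearMap.rTensor_comp, LinearMap.fst_comp_inl,
      LinearMap.snd_comp_inl, LinearMap.rTensor_id, LinearMap.rTensor_zero] at h1 h2
    simp [f] at h1 h2
    have hA : mA m = 0 := by
      rw [← h1] at ht
      simpa using ht
    have hB : mB m = 0 := by
      have := congr((hM.isBaseChange_snd h).equiv $h2)
      simpa [IsBaseChange.equiv_tmul] using this
    rw [← h1, hM.eq_zero m hA hB, tmul_zero]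
  · intro x
    have hx : x ∈ Submodule.span A (Set.range mA) := by rw [hM.span_range_left h]; trivial
    induction hx using Submodule.span_induction with
    | mem x hx =>
      obtain ⟨m, rfl⟩ := hx
      exact ⟨1 ⊗ₜ m, by simp⟩
    | zero => exact ⟨0, map_zero _⟩
    | add x y _ _ hx hy =>
      obtain ⟨x, rfl⟩ := hx
      obtain ⟨y, rfl⟩ := hy
      exact ⟨x + y, map_add _ _ _⟩
    | smul a x hx' hx =>
      obtain ⟨y, hy⟩ := hx
      rw [← hy]
      clear hy hx'
      refine ⟨a • y, ?_⟩
      induction y using TensorProduct.induction_on with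
      | zero => simp
      | tmul b m => simp [smul_tmul', smul_comm b a]
      | add x y hx hy => rw [smul_add, map_add, map_add, hx, hy, smul_add]

end IsGluedModule

end Milnor

/-! ### Flatness of glued modules -/

section Flatness

open TensorProduct

/-- If `M` becomes flat after base change to `A`, then `- ⊗[R] M` preserves injectivity of
`A`-linear maps. -/
lemma rTensor_injective_of_flat_baseChange {R A M N N' : Type*} [CommRing R] [CommRing A]
    [Algebra R A] [AddCommGroup M] [Module R M] [Module.Flat A (A ⊗[R] M)]
    [AddCommGroup N] [Module R N] [Module A N] [IsScalarTower R A N]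
    [AddCommGroup N'] [Module R N'] [Module A N'] [IsScalarTower R A N']
    (f : N →ₗ[A] N') (hf : Function.Injective f) :
    Function.Injective ((f.restrictScalars R).rTensor M) := by
  have h1 : Function.Injective (f.rTensor (A ⊗[R] M)) :=
    Module.Flat.rTensor_preserves_injective_linearMap f hf
  let e := AlgebraTensorModule.cancelBaseChange R A A N M
  let e' := AlgebraTensorModule.cancelBaseChange R A A N' M
  have h2 : ∀ t, (f.restrictScalars R).rTensor M (e t) = e' (f.rTensor _ t) := by
    intro t
    induction t using TensorProduct.induction_on with
    | zero => simp
    | tmul n s =>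
      induction s using TensorProduct.induction_on with
      | zero => simp
      | tmul a m => simp [e, e']
      | add x y hx hy => simp only [tmul_add, map_add, hx, hy]
    | add x y hx hy => simp only [map_add, hx, hy]
  intro x y hxy
  obtain ⟨x, rfl⟩ := e.surjective x
  obtain ⟨y, rfl⟩ := e.surjective y
  rw [h2, h2] at hxy
  rw [h1 (e'.injective hxy)]

variable {R B M : Type*} [CommRing R] [CommRing B] [Algebra R B] [AddCommGroup M] [Module R M]

/-- Let `K → F → F'` be exact with `F'` a `B`-module and `K ⊗ M → F ⊗ M` injective. If `B ⊗ M` is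
flat over `B`, then `L ⊗ M → F ⊗ M` is injective for every submodule `L` of `F` that contains the
image of `K`. -/
lemma rTensor_injective_of_exact
    (hB : Function.Surjective (algebraMap R B)) [Module.Flat B (B ⊗[R] M)]
    {K F F' L : Type*} [AddCommGroup K] [AddCommGroup F] [AddCommGroup F'] [AddCommGroup L]
    [Module R K] [Module R F] [Module R F'] [Module R L] [Module B F'] [IsScalarTower R B F']
    (κ : K →ₗ[R] F) (q : F →ₗ[R] F') (hκq : Function.Exact κ q)
    (hκ : Function.Injective (κ.rTensor M))
    (f : L →ₗ[R] F) (hf : Function.Injective f) (hL : ∀ x, κ x ∈ LinearMap.range f) :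
    Function.Injective (f.rTensor M) := by
  -- the image of `L` in `F'`, which is a `B`-submodule as `R → B` is surjective
  let L' : Submodule B F' :=
    { (LinearMap.range (q ∘ₗ f)) with
      smul_mem' := fun b x hx => by
        obtain ⟨r, rfl⟩ := hB b
        rw [algebraMap_smul]
        exact (LinearMap.range (q ∘ₗ f)).smul_mem r hx }
  let p : L →ₗ[R] L' := (q ∘ₗ f).codRestrict (L'.restrictScalars R) fun x => ⟨x, rfl⟩
  have hp : Function.Surjective p := by
    rintro ⟨_, x, rfl⟩
    exact ⟨x, rfl⟩
  let e := LinearEquiv.ofInjective f hf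
  let s : K →ₗ[R] L := e.symm.toLinearMap ∘ₗ κ.codRestrict (LinearMap.range f) hL
  have hfs : f ∘ₗ s = κ := by
    ext x
    exact congrArg Subtype.val (e.apply_symm_apply (κ.codRestrict (LinearMap.range f) hL x))
  have hsp : Function.Exact s p := by
    intro x
    constructor
    · intro hx
      have hx' : q (f x) = 0 := congrArg Subtype.val hx
      obtain ⟨y, hy⟩ := (hκq _).mp hx'
      exact ⟨y, hf (by rw [← hy, ← hfs]; rfl)⟩
    · rintro ⟨y, rfl⟩
      apply Subtype.ext
      change q (f (s y)) = 0
      rw [← LinearMap.comp_apply f s, hfs]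
      exact (hκq _).mpr ⟨y, rfl⟩
  rw [injective_iff_map_eq_zero]
  intro t ht
  have h1 : Function.Injective ((L'.subtype.restrictScalars R).rTensor M) :=
    rTensor_injective_of_flat_baseChange L'.subtype L'.injective_subtype
  have h2 : p.rTensor M t = 0 := by
    apply h1
    rw [map_zero, ← LinearMap.comp_apply, ← LinearMap.rTensor_comp]
    have : (L'.subtype.restrictScalars R) ∘ₗ p = q ∘ₗ f := rfl
    rw [this, LinearMap.rTensor_comp, LinearMap.comp_apply, ht, map_zero]
  obtain ⟨u, rfl⟩ := (rTensor_exact M hsp hp t).mp h2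
  rw [← LinearMap.comp_apply, ← LinearMap.rTensor_comp, hfs] at ht
  rw [hκ (a₁ := u) (a₂ := 0) (by rw [ht, map_zero]), map_zero]

/-- The case of a free module `F` of `rTensor_injective_of_ker_smul_le`. -/
lemma rTensor_injective_of_ker_smul_le_of_free
    (hB : Function.Surjective (algebraMap R B)) [Module.Flat B (B ⊗[R] M)]
    (hI : Function.Injective
      ((Submodule.subtype (RingHom.ker (algebraMap R B))).rTensor M))
    {F L : Type*} [AddCommGroup F] [Module R F] [Module.Free R F]
    [AddCommGroup L] [Module R L] (f : L →ₗ[R] F) (hf : Function.Injective f)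
    (hL : ∀ r ∈ RingHom.ker (algebraMap R B), ∀ n, r • n ∈ LinearMap.range f) :
    Function.Injective (f.rTensor M) := by
  set I := RingHom.ker (algebraMap R B)
  classical
  let e := (Module.Free.chooseBasis R F).repr
  refine rTensor_injective_of_exact hB (F' := Module.Free.ChooseBasisIndex R F →₀ B)
    (e.symm.toLinearMap ∘ₗ Finsupp.mapRange.linearMap (Submodule.subtype I))
    (Finsupp.mapRange.linearMap (Algebra.linearMap R B) ∘ₗ e.toLinearMap) ?_ ?_ f hf ?_
  · intro x
    constructor
    · intro hx
      have hmem : ∀ i, e x i ∈ I := fun i => by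
        simpa [I, RingHom.mem_ker] using DFunLike.congr_fun hx i
      refine ⟨Finsupp.onFinset (e x).support (fun i => ⟨e x i, hmem i⟩) fun i hi => ?_, ?_⟩
      · rw [Finsupp.mem_support_iff]
        intro h0
        exact hi (Subtype.ext h0)
      · apply e.injective
        ext i
        simp
    · rintro ⟨y, rfl⟩
      ext i
      have := (y i).2
      rw [RingHom.mem_ker] at this
      simpa using this
  · rw [LinearMap.rTensor_comp, LinearMap.coe_comp]
    refine (e.symm.rTensor M).injective.comp ?_
    rw [injective_iff_map_eq_zero]
    intro x hx
    apply (TensorProduct.finsuppLeft R R I M _).injective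
    rw [map_zero]
    ext i
    apply hI
    have key : ∀ x : (_ →₀ I) ⊗[R] M, (Submodule.subtype I).rTensor M
        (TensorProduct.finsuppLeft R R I M _ x i) = TensorProduct.finsuppLeft R R R M _
        ((Finsupp.mapRange.linearMap (Submodule.subtype I)).rTensor M x) i := by
      intro x
      induction x using TensorProduct.induction_on with
      | zero => simp
      | tmul f m => simp [TensorProduct.finsuppLeft_apply_tmul_apply]
      | add x y hx hy => simp only [map_add, Finsupp.add_apply, hx, hy]
    rw [key, hx]
    simp
  · intro x
    induction x using Finsupp.induction_linear with
    | zero => simp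
    | add x y hx hy => rw [map_add]; exact add_mem hx hy
    | single i r =>
      have := hL r r.2 (e.symm (Finsupp.single i 1))
      rw [← map_smul] at this
      simpa using this

/-- Injectivity of `L ⊗ M → N ⊗ M` may be checked after pulling `L ⊆ N` back along a surjection
`F → N`. -/
lemma rTensor_injective_of_comap {F L N : Type*} [AddCommGroup F] [AddCommGroup L] [AddCommGroup N]
    [Module R F] [Module R L] [Module R N] (f : L →ₗ[R] N) (hf : Function.Injective f)
    (π : F →ₗ[R] N) (hπ : Function.Surjective π)
    (hfree : Function.Injective (((LinearMap.range f).comap π).subtype.rTensor M)) :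
    Function.Injective (f.rTensor M) := by
  set L' : Submodule R F := (LinearMap.range f).comap π
  let e := LinearEquiv.ofInjective f hf
  let p : L' →ₗ[R] L := e.symm.toLinearMap ∘ₗ (π.restrict (p := L') (q := LinearMap.range f)
    fun x hx => hx)
  have hfp : f ∘ₗ p = π ∘ₗ L'.subtype := by
    refine LinearMap.ext fun x => ?_
    exact congrArg Subtype.val
      (e.apply_symm_apply ((π.restrict (p := L') (q := LinearMap.range f) fun x hx => hx) x))
  have hp : Function.Surjective p := by
    intro l
    obtain ⟨x, hx⟩ := hπ (f l)
    refine ⟨⟨x, ⟨l, hx.symm⟩⟩, hf ?_⟩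
    rw [← LinearMap.comp_apply, hfp]
    exact hx
  let k : LinearMap.ker π →ₗ[R] L' := Submodule.inclusion fun x hx => by
    change π x ∈ LinearMap.range f
    rw [LinearMap.mem_ker.mp hx]
    exact zero_mem _
  have hker : Function.Exact (L'.subtype ∘ₗ k) π := LinearMap.exact_subtype_ker_map π
  have h3 : p ∘ₗ k = 0 := by
    refine LinearMap.ext fun x => hf ?_
    rw [← LinearMap.comp_apply, ← LinearMap.comp_assoc, hfp]
    exact ((hker _).mpr ⟨x, rfl⟩).trans (map_zero f).symm
  refine LinearMap.ker_eq_bot.mp ((LinearMap.ker_eq_bot').mpr fun t ht => ?_)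
  obtain ⟨t', rfl⟩ := LinearMap.rTensor_surjective M hp t
  have h1 : π.rTensor M (L'.subtype.rTensor M t') = 0 := by
    rw [← LinearMap.comp_apply, ← LinearMap.rTensor_comp, ← hfp, LinearMap.rTensor_comp,
      LinearMap.comp_apply, ht]
  obtain ⟨u, hu⟩ := (rTensor_exact M hker hπ _).mp h1
  have h2 : k.rTensor M u = t' := by
    apply hfree
    rw [← hu, ← LinearMap.comp_apply, ← LinearMap.rTensor_comp]
  rw [← h2, ← LinearMap.comp_apply, ← LinearMap.rTensor_comp, h3, LinearMap.rTensor_zero,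
    LinearMap.zero_apply]

/-- Let `I` be the kernel of the surjection `R → B`. If `I ⊗ M → M` is injective and the base
change of `M` to `B` is flat (so that `Tor₁(M, Q) = 0` for all `Q` killed by `I`), then `- ⊗ M`
preserves injectivity of maps whose cokernel is killed by `I`. -/
lemma rTensor_injective_of_ker_smul_le
    (hB : Function.Surjective (algebraMap R B)) [Module.Flat B (B ⊗[R] M)]
    (hI : Function.Injective
      ((Submodule.subtype (RingHom.ker (algebraMap R B))).rTensor M))
    {L N : Type*} [AddCommGroup L] [AddCommGroup N] [Module R L] [Module R N]
    (f : L →ₗ[R] N) (hf : Function.Injective f)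
    (hL : ∀ r ∈ RingHom.ker (algebraMap R B), ∀ n, r • n ∈ LinearMap.range f) :
    Function.Injective (f.rTensor M) := by
  refine rTensor_injective_of_comap f hf (Finsupp.linearCombination R id)
    (Finsupp.linearCombination_id_surjective R N) ?_
  refine rTensor_injective_of_ker_smul_le_of_free hB hI _ (Submodule.injective_subtype _) ?_
  intro r hr n
  refine ⟨⟨r • n, ?_⟩, rfl⟩
  simpa using hL r hr (Finsupp.linearCombination R id n)

variable {A C : Type*} [CommRing A] [CommRing C] [Algebra R A] [Algebra R C] [Algebra A C]
  [Algebra B C] [IsScalarTower R A C] [IsScalarTower R B C]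

namespace IsMilnorSquare

/-- The kernel of `R → B` is identified with that of `A → C`, and is thereby an ideal of `A`. -/
lemma exists_kerEquiv (h : IsMilnorSquare R A B C) :
    ∃ ψ : RingHom.ker (algebraMap R B) ≃ₗ[R] RingHom.ker (algebraMap A C),
      ∀ x, (ψ x : A) = algebraMap R A x := by
  let IA : Ideal A := RingHom.ker (algebraMap A C)
  let ψ : RingHom.ker (algebraMap R B) →ₗ[R] IA :=
    ((Algebra.linearMap R A).comp (Submodule.subtype _)).codRestrict (IA.restrictScalars R)
      fun x => by
        have hx := RingHom.mem_ker.mp x.2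
        simp [IA, RingHom.mem_ker, ← IsScalarTower.algebraMap_apply R A C,
          IsScalarTower.algebraMap_apply R B C, hx]
  refine ⟨LinearEquiv.ofBijective ψ ⟨?_, ?_⟩, fun _ => rfl⟩
  · rw [injective_iff_map_eq_zero]
    intro x hx
    exact Subtype.ext (h.eq_zero _ (congrArg Subtype.val hx) x.2)
  · rintro ⟨a, ha⟩
    obtain ⟨r, hr, hr'⟩ := h.exists_lift_of_mem_ker ha
    exact ⟨⟨r, hr'⟩, Subtype.ext hr⟩

/-- With `I = ker (R → B) ≅ ker (A → C)` an ideal of `A`, the injectivity of `I ⊗ M → M` follows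
from that of `I ⊗ M → A ⊗ M`. -/
lemma rTensor_ker_injective (h : IsMilnorSquare R A B C) [Module.Flat A (A ⊗[R] M)] :
    Function.Injective ((Submodule.subtype (RingHom.ker (algebraMap R B))).rTensor M) := by
  obtain ⟨ψ, hψ⟩ := h.exists_kerEquiv
  let IA : Ideal A := RingHom.ker (algebraMap A C)
  have h1 : Function.Injective ((IA.subtype.restrictScalars R).rTensor M) :=
    rTensor_injective_of_flat_baseChange IA.subtype IA.injective_subtype
  have h2 : Function.Injective (ψ.toLinearMap.rTensor M) := (ψ.rTensor M).injective
  have h3 := h1.comp h2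
  rw [← LinearMap.coe_comp, ← LinearMap.rTensor_comp] at h3
  have h4 : (IA.subtype.restrictScalars R) ∘ₗ ψ.toLinearMap =
      (Algebra.linearMap R A) ∘ₗ (Submodule.subtype (RingHom.ker (algebraMap R B))) :=
    LinearMap.ext hψ
  rw [h4, LinearMap.rTensor_comp, LinearMap.coe_comp] at h3
  exact h3.of_comp

/-- The extension of an ideal `J` of `R` to `A × B` exceeds `J` only by elements whose multiples
by the kernel of `R → B` lie in `J`. -/
lemma exists_mem_of_mem_map (h : IsMilnorSquare R A B C) (J : Ideal R) {x : A}
    (hx : x ∈ J.map (algebraMap R A)) (r : R) (hr : algebraMap R B r = 0) :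
    ∃ j ∈ J, algebraMap R A j = algebraMap R A r * x ∧ algebraMap R B j = 0 := by
  induction hx using Submodule.span_induction generalizing r with
  | mem x hx =>
    obtain ⟨j, hj, rfl⟩ := hx
    exact ⟨r * j, J.mul_mem_left _ hj, map_mul _ _ _, by rw [map_mul, hr, zero_mul]⟩
  | zero => exact ⟨0, zero_mem _, by simp, map_zero _⟩
  | add x y _ _ hx hy =>
    obtain ⟨j, hj, hjA, hjB⟩ := hx r hr
    obtain ⟨k, hk, hkA, hkB⟩ := hy r hr
    exact ⟨j + k, add_mem hj hk, by rw [map_add, hjA, hkA, mul_add],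
      by rw [map_add, hjB, hkB, add_zero]⟩
  | smul a x _ hx =>
    obtain ⟨r', hr', hrB'⟩ := h.exists_lift_of_mem_ker (a := algebraMap R A r * a) (by
      rw [RingHom.mem_ker, map_mul, ← IsScalarTower.algebraMap_apply R A C,
        IsScalarTower.algebraMap_apply R B C, hr, map_zero, zero_mul])
    obtain ⟨j, hj, hjA, hjB⟩ := hx r' hrB'
    exact ⟨j, hj, by rw [hjA, hr', smul_eq_mul, mul_assoc], hjB⟩

/-- **Descent of flatness along a Milnor square.** For an ideal `J` of `R`, the injectivity of
`J ⊗ M → M` follows from that of `J ⊗ M → (JA × JB) ⊗ M`, whose cokernel is killed by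
`ker (R → B)`, and of `(JA × JB) ⊗ M → (A × B) ⊗ M`. -/
theorem flat (h : IsMilnorSquare R A B C)
    [Module.Flat A (A ⊗[R] M)] [Module.Flat B (B ⊗[R] M)] : Module.Flat R M := by
  rw [Module.Flat.iff_rTensor_injective']
  intro J
  let JA := J.map (algebraMap R A)
  let JB := J.map (algebraMap R B)
  let κA : J →ₗ[R] JA := ((Algebra.linearMap R A).comp J.subtype).codRestrict
    (JA.restrictScalars R) fun x => Ideal.mem_map_of_mem _ x.2
  let κB : J →ₗ[R] JB := ((Algebra.linearMap R B).comp J.subtype).codRestrict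
    (JB.restrictScalars R) fun x => Ideal.mem_map_of_mem _ x.2
  let κ : J →ₗ[R] JA × JB := κA.prod κB
  have hκ : Function.Injective κ := by
    rw [injective_iff_map_eq_zero]
    intro x hx
    exact Subtype.ext (h.eq_zero _ congr(($hx).1.1) congr(($hx).2.1))
  have h1 : Function.Injective (κ.rTensor M) := by
    refine rTensor_injective_of_ker_smul_le h.surjective_right h.rTensor_ker_injective κ hκ ?_
    rintro r hr ⟨⟨x, hx⟩, ⟨y, hy⟩⟩
    obtain ⟨j, hj, hjA, hjB⟩ := h.exists_mem_of_mem_map J hx r hr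
    refine ⟨⟨j, hj⟩, Prod.ext (Subtype.ext ?_) (Subtype.ext ?_)⟩
    · exact hjA.trans (Algebra.smul_def r x).symm
    · change algebraMap R B j = r • y
      rw [hjB, Algebra.smul_def, RingHom.mem_ker.mp hr, zero_mul]
  have hA : Function.Injective ((JA.subtype.restrictScalars R).rTensor M) :=
    rTensor_injective_of_flat_baseChange JA.subtype JA.injective_subtype
  have hB : Function.Injective ((JB.subtype.restrictScalars R).rTensor M) :=
    rTensor_injective_of_flat_baseChange JB.subtype JB.injective_subtype
  rw [injective_iff_map_eq_zero]
  intro t ht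
  have hA0 : κA.rTensor M t = 0 := by
    apply hA
    have : (JA.subtype.restrictScalars R) ∘ₗ κA = Algebra.linearMap R A ∘ₗ J.subtype := rfl
    rw [← LinearMap.comp_apply, ← LinearMap.rTensor_comp, this, LinearMap.rTensor_comp,
      LinearMap.comp_apply, ht, map_zero, map_zero]
  have hB0 : κB.rTensor M t = 0 := by
    apply hB
    have : (JB.subtype.restrictScalars R) ∘ₗ κB = Algebra.linearMap R B ∘ₗ J.subtype := rfl
    rw [← LinearMap.comp_apply, ← LinearMap.rTensor_comp, this, LinearMap.rTensor_comp,
      LinearMap.comp_apply, ht, map_zero, map_zero]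
  apply h1
  have hsum : κ = LinearMap.inl R JA JB ∘ₗ κA + LinearMap.inr R JA JB ∘ₗ κB := by
    refine LinearMap.ext fun x => ?_
    simp [κ]
  rw [hsum, LinearMap.rTensor_add, LinearMap.rTensor_comp, LinearMap.rTensor_comp]
  simp [hA0, hB0]

/-- A module that vanishes after base change to `A` and to `B` vanishes: `N = I N` is a quotient of
`I ⊗[R] N = I ⊗[A] (A ⊗[R] N)`. -/
lemma subsingleton_of_baseChange (h : IsMilnorSquare R A B C) [Subsingleton (A ⊗[R] M)]
    [Subsingleton (B ⊗[R] M)] : Subsingleton M := by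
  obtain ⟨ψ, -⟩ := h.exists_kerEquiv
  have hI : Subsingleton (RingHom.ker (algebraMap R B) ⊗[R] M) :=
    ((ψ.rTensor M).toEquiv.trans (AlgebraTensorModule.cancelBaseChange R A A
      (RingHom.ker (algebraMap A C)) M).symm.toEquiv).subsingleton
  have hex := rTensor_exact M (LinearMap.exact_subtype_ker_map (Algebra.linearMap R B))
    h.surjective_right
  refine (TensorProduct.lid R M).symm.toEquiv.subsingleton_congr.mpr ⟨fun x y => ?_⟩
  obtain ⟨u, hu⟩ := (hex (x - y)).mp (Subsingleton.elim _ _)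
  have : u = 0 := Subsingleton.elim (α := RingHom.ker (algebraMap R B) ⊗[R] M) _ _
  rw [this, map_zero] at hu
  exact sub_eq_zero.mp hu.symm

end IsMilnorSquare

end Flatness

/-! ### Smoothness of glued algebras -/

section Smoothness

open TensorProduct

/-- If `T ⊗ K` is a finite `T`-module, then `T ⊗ (K / N') = 0` for all sufficiently large
submodules `N'` of `K`. -/
lemma Module.Finite.exists_fg_subsingleton_tensor_quotient {P K : Type*} [CommRing P]
    [AddCommGroup K] [Module P K] (T : Type*) [CommRing T] [Algebra P T]
    [Module.Finite T (T ⊗[P] K)] :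
    ∃ N : Submodule P K, N.FG ∧ ∀ N' : Submodule P K, N ≤ N' →
      Subsingleton (T ⊗[P] (K ⧸ N')) := by
  classical
  obtain ⟨n, s, hs⟩ := Module.Finite.exists_fin (R := T) (M := T ⊗[P] K)
  choose k t m h using fun i : Fin n ↦ TensorProduct.exists_sum_tmul_eq (s i)
  refine ⟨Submodule.span P (Set.range fun x : Σ i, Fin (k i) => m x.1 x.2),
    Submodule.fg_span (Set.finite_range _), fun N' hN' => ?_⟩
  have hzero : AlgebraTensorModule.lTensor T T N'.mkQ = 0 := by
    have hle : (⊤ : Submodule T (T ⊗[P] K)) ≤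
        LinearMap.ker (AlgebraTensorModule.lTensor T T N'.mkQ) := by
      rw [← hs, Submodule.span_le, Set.range_subset_iff]
      intro i
      have hm : ∀ j, (Submodule.Quotient.mk (m i j) : K ⧸ N') = 0 := fun j =>
        (Submodule.Quotient.mk_eq_zero _).mpr (hN' (Submodule.subset_span ⟨⟨i, j⟩, rfl⟩))
      simp [h i, hm]
    exact LinearMap.ker_eq_top.mp (top_le_iff.mp hle)
  have hsurj : Function.Surjective (LinearMap.lTensor T N'.mkQ) :=
    LinearMap.lTensor_surjective T N'.mkQ_surjective
  have h0 : ∀ y : T ⊗[P] (K ⧸ N'), y = 0 := fun y => by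
    obtain ⟨x, rfl⟩ := hsurj y
    exact DFunLike.congr_fun hzero x
  exact ⟨fun x y => (h0 x).trans (h0 y).symm⟩

/-- If vanishing of quotients of `K` is detected after base change to `T` and `T'`, then so is
finiteness of `K`. -/
lemma Module.Finite.of_finite_baseChange {P K : Type*} [CommRing P] [AddCommGroup K] [Module P K]
    (T T' : Type*) [CommRing T] [CommRing T'] [Algebra P T] [Algebra P T']
    [Module.Finite T (T ⊗[P] K)] [Module.Finite T' (T' ⊗[P] K)]
    (H : ∀ N : Submodule P K, Subsingleton (T ⊗[P] (K ⧸ N)) → Subsingleton (T' ⊗[P] (K ⧸ N)) →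
      Subsingleton (K ⧸ N)) :
    Module.Finite P K := by
  obtain ⟨N, hN, hN'⟩ := exists_fg_subsingleton_tensor_quotient (P := P) (K := K) T
  obtain ⟨N₁, hN₁, hN₁'⟩ := exists_fg_subsingleton_tensor_quotient (P := P) (K := K) T'
  have := H (N ⊔ N₁) (hN' _ le_sup_left) (hN₁' _ le_sup_right)
  rw [Submodule.Quotient.subsingleton_iff] at this
  exact ⟨this ▸ hN.sup hN₁⟩

lemma LinearMap.subsingleton_tensor_quotient_range {R N N' : Type*} [CommRing R] [AddCommGroup N]
    [AddCommGroup N'] [Module R N] [Module R N'] (f : N →ₗ[R] N') (T : Type*) [CommRing T]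
    [Algebra R T] (hT : Function.Surjective (f.lTensor T)) :
    Subsingleton (T ⊗[R] (N' ⧸ LinearMap.range f)) := by
  have hsurj : Function.Surjective (LinearMap.lTensor T (LinearMap.range f).mkQ) :=
    LinearMap.lTensor_surjective T (Submodule.mkQ_surjective _)
  have h0 : ∀ y : T ⊗[R] (N' ⧸ LinearMap.range f), y = 0 := fun y => by
    obtain ⟨x, rfl⟩ := hsurj y
    obtain ⟨x, rfl⟩ := hT x
    rw [← LinearMap.comp_apply, ← LinearMap.lTensor_comp, LinearMap.range_mkQ_comp]
    simp
  exact ⟨fun x y => (h0 x).trans (h0 y).symm⟩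

/-- If `T ⊗ S` is a `T`-algebra of finite type, then all sufficiently large subalgebras of `S`
become equal to `S` after base change to `T`. -/
lemma Algebra.FiniteType.exists_finset_surjective_lTensor {R S : Type*} [CommRing R] [CommRing S]
    [Algebra R S] (T : Type*) [CommRing T] [Algebra R T] [Algebra.FiniteType T (T ⊗[R] S)] :
    ∃ s : Finset S, ∀ S' : Subalgebra R S, (s : Set S) ⊆ S' →
      Function.Surjective (S'.val.toLinearMap.lTensor T) := by
  classical
  obtain ⟨s, hs⟩ := Algebra.FiniteType.out (R := T) (A := T ⊗[R] S)
  choose k t m hm using fun x : s ↦ TensorProduct.exists_sum_tmul_eq x.1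
  refine ⟨Finset.univ.image fun x : Σ x : s, Fin (k x) => m x.1 x.2, fun S' hS' => ?_⟩
  have hf : Function.Surjective (Algebra.TensorProduct.map (.id T T) S'.val) := by
    rw [← AlgHom.range_eq_top, _root_.eq_top_iff, ← hs, Algebra.adjoin_le_iff]
    intro x hx
    have hmem : ∀ j, m ⟨x, hx⟩ j ∈ S' := fun j => hS' (by
      simp only [Finset.coe_image, Finset.coe_univ, Set.image_univ]
      exact ⟨⟨⟨x, hx⟩, j⟩, rfl⟩)
    refine ⟨∑ j, t ⟨x, hx⟩ j ⊗ₜ ⟨m ⟨x, hx⟩ j, hmem j⟩, ?_⟩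
    simpa using (hm ⟨x, hx⟩).symm
  exact hf

attribute [local instance] Algebra.TensorProduct.rightAlgebra in
/-- The relations among generators of a flat algebra that becomes finitely presented over `T` form
a finite module after base change to `T`. -/
lemma Algebra.finite_tensor_ker_of_finitePresentation {R S P : Type*} [CommRing R] [CommRing S]
    [CommRing P] [Algebra R S] [Algebra R P] [Algebra P S] [IsScalarTower R P S] [Module.Flat R S]
    (hf : Function.Surjective (algebraMap P S)) (T : Type*) [CommRing T] [Algebra R T]
    [Algebra.FinitePresentation R P] [Algebra.FinitePresentation T (T ⊗[R] S)] :
    Module.Finite (T ⊗[R] P) ((T ⊗[R] P) ⊗[P] RingHom.ker (algebraMap P S)) := by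
  have hfg : (RingHom.ker (Algebra.TensorProduct.map (.id T T)
      (IsScalarTower.toAlgHom R P S)).toRingHom).FG := by
    apply Algebra.FinitePresentation.ker_fG_of_surjective
    exact LinearMap.lTensor_surjective T (g := (IsScalarTower.toAlgHom R P S).toLinearMap) hf
  have : Module.Finite (T ⊗[R] P) (RingHom.ker (Algebra.TensorProduct.map (.id T T)
      (IsScalarTower.toAlgHom R P S))) := Module.Finite.iff_fg.mpr hfg
  exact .equiv (Algebra.kerTensorProductMapIdToAlgHomEquiv _ _ _ _ hf)

namespace IsMilnorSquare

variable {R A B C : Type*} [CommRing R] [CommRing A] [CommRing B] [CommRing C]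
  [Algebra R A] [Algebra R B] [Algebra R C] [Algebra A C] [Algebra B C]
  [IsScalarTower R A C] [IsScalarTower R B C]

lemma surjective_of_lTensor (h : IsMilnorSquare R A B C) {N N' : Type*} [AddCommGroup N]
    [AddCommGroup N'] [Module R N] [Module R N'] (f : N →ₗ[R] N')
    (hA : Function.Surjective (f.lTensor A)) (hB : Function.Surjective (f.lTensor B)) :
    Function.Surjective f := by
  have := f.subsingleton_tensor_quotient_range A hA
  have := f.subsingleton_tensor_quotient_range B hB
  have := h.subsingleton_of_baseChange (M := N' ⧸ LinearMap.range f)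
  rw [Submodule.Quotient.subsingleton_iff] at this
  exact LinearMap.range_eq_top.mp this

variable {S : Type*} [CommRing S] [Algebra R S]

/-- **Descent of finite type along a Milnor square.** -/
lemma finiteType (h : IsMilnorSquare R A B C) [Algebra.FiniteType A (A ⊗[R] S)]
    [Algebra.FiniteType B (B ⊗[R] S)] : Algebra.FiniteType R S := by
  classical
  obtain ⟨s, hs⟩ := Algebra.FiniteType.exists_finset_surjective_lTensor (R := R) (S := S) A
  obtain ⟨s', hs'⟩ := Algebra.FiniteType.exists_finset_surjective_lTensor (R := R) (S := S) B
  refine ⟨⟨s ∪ s', ?_⟩⟩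
  have := h.surjective_of_lTensor (Algebra.adjoin R ((s ∪ s' : Finset S) : Set S)).val.toLinearMap
    (hs _ ((by simp : (s : Set S) ⊆ _).trans Algebra.subset_adjoin))
    (hs' _ ((by simp : (s' : Set S) ⊆ _).trans Algebra.subset_adjoin))
  rw [_root_.eq_top_iff]
  intro x _
  obtain ⟨y, rfl⟩ := this x
  exact y.2

attribute [local instance] Algebra.TensorProduct.rightAlgebra in
/-- **Descent of finite presentation along a Milnor square** for flat algebras. -/
lemma finitePresentation (h : IsMilnorSquare R A B C) [Module.Flat R S]
    [Algebra.FinitePresentation A (A ⊗[R] S)]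
    [Algebra.FinitePresentation B (B ⊗[R] S)] : Algebra.FinitePresentation R S := by
  have := h.finiteType (S := S)
  rw [Algebra.FiniteType.iff_quotient_mvPolynomial''] at this
  obtain ⟨n, f, hf⟩ := this
  let P := MvPolynomial (Fin n) R
  algebraize [f.toRingHom]
  have : IsScalarTower R P S := .of_algebraMap_eq' f.comp_algebraMap.symm
  have := Algebra.finite_tensor_ker_of_finitePresentation (R := R) (P := P) hf A
  have := Algebra.finite_tensor_ker_of_finitePresentation (R := R) (P := P) hf B
  have : Module.Finite P (RingHom.ker (algebraMap P S)) := by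
    refine .of_finite_baseChange (A ⊗[R] P) (B ⊗[R] P) fun N hA hB => ?_
    have := (Algebra.IsPushout.cancelBaseChange R A P (A ⊗[R] P)
      (RingHom.ker (algebraMap P S) ⧸ N)).symm.toEquiv.subsingleton
    have := (Algebra.IsPushout.cancelBaseChange R B P (B ⊗[R] P)
      (RingHom.ker (algebraMap P S) ⧸ N)).symm.toEquiv.subsingleton
    exact h.subsingleton_of_baseChange
  exact .of_surjective hf (Module.Finite.iff_fg.mp this)

/-- A residue field of `R` is an algebra over `A` or over `B`: outside the closed subset `Spec B`
the map `Spec A → Spec R` is a local isomorphism. -/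
lemma exists_algHom_of_field (h : IsMilnorSquare R A B C) (K : Type*) [Field K] [Algebra R K] :
    Nonempty (A →ₐ[R] K) ∨ Nonempty (B →ₐ[R] K) := by
  by_cases hK : RingHom.ker (algebraMap R B) ≤ RingHom.ker (algebraMap R K)
  · right
    let g := RingHom.liftOfSurjective (algebraMap R B) h.surjective_right ⟨algebraMap R K, hK⟩
    exact ⟨⟨g, fun r => RingHom.liftOfRightInverse_comp_apply _ _ _ ⟨algebraMap R K, hK⟩ r⟩⟩
  · left
    obtain ⟨f, hfB, hfK⟩ := SetLike.not_le_iff_exists.mp hK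
    rw [RingHom.mem_ker] at hfB hfK
    -- `a ↦ a f` maps `A` to `R`
    have hex : ∀ a : A, ∃ r : R, algebraMap R A r = a * algebraMap R A f ∧ algebraMap R B r = 0 :=
      fun a => h.exists_lift_of_mem_ker (by
        rw [RingHom.mem_ker, map_mul, ← IsScalarTower.algebraMap_apply R A C,
          IsScalarTower.algebraMap_apply R B C, hfB, map_zero, mul_zero])
    choose ρ hρA hρB using hex
    have hinj : ∀ r s : R, algebraMap R A r = algebraMap R A s →
        algebraMap R B r = algebraMap R B s → r = s := fun r s hA hB =>
      sub_eq_zero.mp (h.eq_zero _ (by rw [map_sub, hA, sub_self]) (by rw [map_sub, hB, sub_self]))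
    have hmap : ∀ r : R, ρ (algebraMap R A r) = r * f := fun r => hinj _ _
      (by rw [hρA, map_mul]) (by rw [hρB, map_mul, hfB, mul_zero])
    refine ⟨⟨⟨⟨⟨fun a => algebraMap R K (ρ a) / algebraMap R K f, ?_⟩, ?_⟩, ?_, ?_⟩, ?_⟩⟩
    · rw [← map_one (algebraMap R A), hmap, one_mul, div_self hfK]
    · intro a b
      have : ρ (a * b) * f = ρ a * ρ b := hinj _ _
        (by simp only [map_mul, hρA]; ring) (by simp only [map_mul, hρB, zero_mul])
      have := congr(algebraMap R K $this)
      rw [map_mul, map_mul] at this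
      simp only
      field_simp
      exact this
    · have : ρ 0 = 0 := hinj _ _ (by rw [hρA, zero_mul, map_zero]) (by rw [hρB, map_zero])
      simp [this]
    · intro a b
      have : ρ (a + b) = ρ a + ρ b := hinj _ _ (by simp only [map_add, hρA, add_mul])
        (by simp only [map_add, hρB, add_zero])
      simp [this, add_div]
    · intro r
      simp [hmap, hfK]

omit [Algebra R C] [IsScalarTower R A C] [IsScalarTower R B C] in
lemma _root_.Algebra.FormallySmooth.of_smooth_of_algHom {T K : Type*} [CommRing T] [Algebra R T]
    [Field K] [Algebra R K] [Algebra.Smooth T (T ⊗[R] S)] (φ : T →ₐ[R] K) :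
    Algebra.FormallySmooth K (K ⊗[R] S) := by
  algebraize [φ.toRingHom]
  have : IsScalarTower R T K := .of_algebraMap_eq' φ.comp_algebraMap.symm
  exact .of_equiv (Algebra.TensorProduct.cancelBaseChange R T K K S)

/-- **Descent of smoothness along a Milnor square.** -/
theorem smooth (h : IsMilnorSquare R A B C) [Algebra.Smooth A (A ⊗[R] S)]
    [Algebra.Smooth B (B ⊗[R] S)] : Algebra.Smooth R S := by
  have : Module.Flat R S := h.flat
  have : Algebra.FinitePresentation R S := h.finitePresentation
  refine .of_formallySmooth_fiber fun p hp => ?_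
  obtain ⟨⟨φ⟩⟩ | ⟨⟨φ⟩⟩ := h.exists_algHom_of_field p.ResidueField
  · exact .of_smooth_of_algHom φ
  · exact .of_smooth_of_algHom φ

end IsMilnorSquare

end Smoothness

/-! ### Morphisms of Milnor squares -/

section MilnorMap

lemma CommRingCat.ext_of_isPullback {R A B C : CommRingCat.{u}} {f : R ⟶ A} {g : R ⟶ B}
    {α : A ⟶ C} {β : B ⟶ C} (h : IsPullback f g α β) {r s : R} (hf : f r = f s) (hg : g r = g s) :
    r = s :=
  Limits.Types.ext_of_isPullback (h.map (forget CommRingCat)) hf hg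

lemma CommRingCat.exists_of_isPullback {R A B C : CommRingCat.{u}} {f : R ⟶ A} {g : R ⟶ B}
    {α : A ⟶ C} {β : B ⟶ C} (h : IsPullback f g α β) (a : A) (b : B) (hab : α a = β b) :
    ∃ r : R, f r = a ∧ g r = b :=
  Limits.Types.exists_of_isPullback (h.map (forget CommRingCat)) a b hab

/-- A morphism of cartesian squares of rings, from `R₂ = A₂ ×_{C₂} B₂` with `A₂ → C₂` surjective to
`R₁ = A₁ ×_{C₁} B₁`, such that `C₁` is the base change of `A₁` and of `B₁`. -/
structure IsMilnorMap {R₁ A₁ B₁ C₁ R₂ A₂ B₂ C₂ : CommRingCat.{u}}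
    (rA₁ : R₁ ⟶ A₁) (rB₁ : R₁ ⟶ B₁) (α₁ : A₁ ⟶ C₁) (β₁ : B₁ ⟶ C₁)
    (rA₂ : R₂ ⟶ A₂) (rB₂ : R₂ ⟶ B₂) (α₂ : A₂ ⟶ C₂) (β₂ : B₂ ⟶ C₂)
    (φR : R₂ ⟶ R₁) (φA : A₂ ⟶ A₁) (φB : B₂ ⟶ B₁) (φC : C₂ ⟶ C₁) : Prop where
  isPullback₁ : IsPullback rA₁ rB₁ α₁ β₁
  isPullback₂ : IsPullback rA₂ rB₂ α₂ β₂
  surjective : Function.Surjective α₂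
  wA : rA₂ ≫ φA = φR ≫ rA₁
  wB : rB₂ ≫ φB = φR ≫ rB₁
  isPushout_left : IsPushout α₂ φA φC α₁
  isPushout_right : IsPushout β₂ φB φC β₁

namespace IsMilnorMap

variable {R₁ A₁ B₁ C₁ R₂ A₂ B₂ C₂ : CommRingCat.{u}}
  {rA₁ : R₁ ⟶ A₁} {rB₁ : R₁ ⟶ B₁} {α₁ : A₁ ⟶ C₁} {β₁ : B₁ ⟶ C₁}
  {rA₂ : R₂ ⟶ A₂} {rB₂ : R₂ ⟶ B₂} {α₂ : A₂ ⟶ C₂} {β₂ : B₂ ⟶ C₂}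
  {φR : R₂ ⟶ R₁} {φA : A₂ ⟶ A₁} {φB : B₂ ⟶ B₁} {φC : C₂ ⟶ C₁}

/-- The algebra `R₁` over `R₂` inherits from `A₁` over `A₂` and `B₁` over `B₂` every property that
is stable under isomorphism and descends along Milnor squares. -/
lemma of_isMilnorSquare (h : IsMilnorMap rA₁ rB₁ α₁ β₁ rA₂ rB₂ α₂ β₂ φR φA φB φC)
    (P : ∀ {R S : Type u} [CommRing R] [CommRing S], (R →+* S) → Prop) (hP : RingHom.RespectsIso P)
    (H : ∀ (R A B C S : Type u) [CommRing R] [CommRing A] [CommRing B] [CommRing C] [CommRing S]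
      [Algebra R A] [Algebra R B] [Algebra R C] [Algebra A C] [Algebra B C] [IsScalarTower R A C]
      [IsScalarTower R B C] [Algebra R S], IsMilnorSquare R A B C →
      P (algebraMap A (TensorProduct R A S)) → P (algebraMap B (TensorProduct R B S)) →
      P (algebraMap R S))
    (hA : P φA.hom) (hB : P φB.hom) : P φR.hom := by
  let := rA₂.hom.toAlgebra
  let := rB₂.hom.toAlgebra
  let := α₂.hom.toAlgebra
  let := β₂.hom.toAlgebra
  let := (rA₂ ≫ α₂).hom.toAlgebra
  let := φR.hom.toAlgebra
  let := φA.hom.toAlgebra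
  let := φB.hom.toAlgebra
  let := φC.hom.toAlgebra
  let := rA₁.hom.toAlgebra
  let := rB₁.hom.toAlgebra
  let := α₁.hom.toAlgebra
  let := β₁.hom.toAlgebra
  let := (rA₂ ≫ φA).hom.toAlgebra
  let := (rB₂ ≫ φB).hom.toAlgebra
  let := (rA₂ ≫ α₂ ≫ φC).hom.toAlgebra
  let := (α₂ ≫ φC).hom.toAlgebra
  let := (β₂ ≫ φC).hom.toAlgebra
  have : IsScalarTower R₂ A₂ C₂ := .of_algebraMap_eq' rfl
  have : IsScalarTower R₂ B₂ C₂ := .of_algebraMap_eq' congr(($(h.isPullback₂.w)).hom)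
  have : IsScalarTower R₂ A₂ A₁ := .of_algebraMap_eq' rfl
  have : IsScalarTower R₂ B₂ B₁ := .of_algebraMap_eq' rfl
  have : IsScalarTower R₂ R₁ A₁ := .of_algebraMap_eq' congr(($(h.wA)).hom)
  have : IsScalarTower R₂ R₁ B₁ := .of_algebraMap_eq' congr(($(h.wB)).hom)
  have : IsScalarTower A₂ C₂ C₁ := .of_algebraMap_eq' rfl
  have : IsScalarTower B₂ C₂ C₁ := .of_algebraMap_eq' rfl
  have : IsScalarTower A₂ A₁ C₁ := .of_algebraMap_eq' congr(($(h.isPushout_left.w)).hom)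
  have : IsScalarTower B₂ B₁ C₁ := .of_algebraMap_eq' congr(($(h.isPushout_right.w)).hom)
  have : IsScalarTower R₂ A₂ C₁ := .of_algebraMap_eq' rfl
  have : IsScalarTower R₂ C₂ C₁ := .of_algebraMap_eq' rfl
  have : IsScalarTower R₂ B₂ C₁ := .of_algebraMap_eq' (by
    have := congr(($(h.isPullback₂.w) ≫ φC).hom)
    simpa using! this)
  have hsq : IsMilnorSquare R₂ A₂ B₂ C₂ :=
    { surjective := h.surjective
      eq_zero := fun r hA hB => CommRingCat.ext_of_isPullback h.isPullback₂
        (hA.trans (map_zero rA₂.hom).symm) (hB.trans (map_zero rB₂.hom).symm)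
      exists_lift := fun a b hab => CommRingCat.exists_of_isPullback h.isPullback₂ a b hab }
  have pA : Algebra.IsPushout A₂ C₂ A₁ C₁ :=
    CommRingCat.isPushout_iff_isPushout.mp h.isPushout_left
  have pB : Algebra.IsPushout B₂ C₂ B₁ C₁ :=
    CommRingCat.isPushout_iff_isPushout.mp h.isPushout_right
  have hM : IsGluedModule A₂ B₂ C₂ (IsScalarTower.toAlgHom R₂ R₁ A₁).toLinearMap
      (IsScalarTower.toAlgHom R₂ R₁ B₁).toLinearMap (IsScalarTower.toAlgHom A₂ A₁ C₁).toLinearMap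
      (IsScalarTower.toAlgHom B₂ B₁ C₁).toLinearMap :=
    { w := fun m => congr($(h.isPullback₁.w) m)
      eq_zero := fun r hA hB => CommRingCat.ext_of_isPullback h.isPullback₁
        (hA.trans (map_zero rA₁.hom).symm) (hB.trans (map_zero rB₁.hom).symm)
      exists_lift := fun a b hab => CommRingCat.exists_of_isPullback h.isPullback₁ a b hab
      isBaseChange_left := pA.out
      isBaseChange_right := pB.out }
  have qA : Algebra.IsPushout R₂ A₂ R₁ A₁ := ⟨hM.isBaseChange_fst hsq⟩
  have qB : Algebra.IsPushout R₂ B₂ R₁ B₁ := ⟨hM.isBaseChange_snd hsq⟩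
  refine H R₂ A₂ B₂ C₂ R₁ hsq ?_ ?_
  · have := hP.1 φA.hom (Algebra.IsPushout.equiv R₂ A₂ R₁ A₁).symm.toRingEquiv hA
    rwa [show ((Algebra.IsPushout.equiv R₂ A₂ R₁ A₁).symm.toRingEquiv.toRingHom).comp φA.hom =
      algebraMap A₂ (TensorProduct R₂ A₂ R₁) from
      (Algebra.IsPushout.equiv R₂ A₂ R₁ A₁).symm.toAlgHom.comp_algebraMap] at this
  · have := hP.1 φB.hom (Algebra.IsPushout.equiv R₂ B₂ R₁ B₁).symm.toRingEquiv hB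
    rwa [show ((Algebra.IsPushout.equiv R₂ B₂ R₁ B₁).symm.toRingEquiv.toRingHom).comp φB.hom =
      algebraMap B₂ (TensorProduct R₂ B₂ R₁) from
      (Algebra.IsPushout.equiv R₂ B₂ R₁ B₁).symm.toAlgHom.comp_algebraMap] at this

theorem flat (h : IsMilnorMap rA₁ rB₁ α₁ β₁ rA₂ rB₂ α₂ β₂ φR φA φB φC)
    (hA : φA.hom.Flat) (hB : φB.hom.Flat) : φR.hom.Flat := by
  refine h.of_isMilnorSquare RingHom.Flat RingHom.Flat.respectsIso ?_ hA hB
  intro R A B C S _ _ _ _ _ _ _ _ _ _ _ _ _ hsq hA hB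
  rw [RingHom.flat_algebraMap_iff] at hA hB ⊢
  exact hsq.flat

theorem smooth (h : IsMilnorMap rA₁ rB₁ α₁ β₁ rA₂ rB₂ α₂ β₂ φR φA φB φC)
    (hA : φA.hom.Smooth) (hB : φB.hom.Smooth) : φR.hom.Smooth := by
  refine h.of_isMilnorSquare RingHom.Smooth RingHom.Smooth.respectsIso ?_ hA hB
  intro R A B C S _ _ _ _ _ _ _ _ _ _ _ _ _ hsq hA hB
  rw [RingHom.smooth_algebraMap] at hA hB ⊢
  exact hsq.smooth

end IsMilnorMap

end MilnorMap

/-! ### Push-outs of locally ringed spaces -/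

section LRSPushout

open Opposite TopologicalSpace

/-- Open subsets of `X` and `V` with the same preimage in `Z` come from an open subset of the
push-out. -/
lemma TopCat.exists_opens_of_isPushout {Z X V P : TopCat.{u}} {i : Z ⟶ X} {g : Z ⟶ V} {p : X ⟶ P}
    {j : V ⟶ P} (h : IsPushout i g p j) (W : Opens X) (U : Opens V)
    (hWU : (Opens.map i).obj W = (Opens.map g).obj U) :
    ∃ O : Opens P, (Opens.map p).obj O = W ∧ (Opens.map j).obj O = U := by
  -- open subsets are continuous maps to the Sierpiński space
  let S : TopCat.{u} := TopCat.of (ULift.{u} Prop)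
  let w : X ⟶ S := TopCat.ofHom ⟨fun x => ⟨x ∈ W⟩,
    continuous_uliftUp.comp (isOpen_iff_continuous_mem.mp W.2)⟩
  let v : V ⟶ S := TopCat.ofHom ⟨fun x => ⟨x ∈ U⟩,
    continuous_uliftUp.comp (isOpen_iff_continuous_mem.mp U.2)⟩
  have hwv : i ≫ w = g ≫ v := by
    ext z
    have := congr(z ∈ $hWU)
    exact iff_of_eq this
  let o := h.desc w v hwv
  refine ⟨⟨{x | (o x).down}, isOpen_iff_continuous_mem.mpr
    (continuous_uliftDown.comp o.hom.continuous)⟩, ?_, ?_⟩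
  · ext x
    have := congr(($(h.inl_desc w v hwv) x).down)
    exact iff_of_eq this
  · ext x
    have := congr(($(h.inr_desc w v hwv) x).down)
    exact iff_of_eq this

lemma TopCat.mem_range_of_isPushout {Z X V P : TopCat.{u}} {i : Z ⟶ X} {g : Z ⟶ V} {p : X ⟶ P}
    {j : V ⟶ P} (h : IsPushout i g p j) (y : P) : (∃ x, p x = y) ∨ ∃ v, j v = y := by
  obtain ⟨k, x, hx⟩ := Limits.Concrete.isColimit_exists_rep _ h.isColimit y
  match k with
  | .left => exact .inl ⟨x, hx⟩
  | .right => exact .inr ⟨x, hx⟩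
  | .zero =>
    refine .inl ⟨i x, hx ▸ ?_⟩
    exact congr($(h.cocone.w Limits.WalkingSpan.Hom.fst) x)

namespace CategoryTheory

open Limits

/-- The limit of a diagram indexed by the opposite of a span is a fibre product. -/
lemma isPullback_limit_walkingSpan_op {C : Type*} [Category C] (D : WalkingSpanᵒᵖ ⥤ C)
    [HasLimit D] :
    IsPullback (limit.π D (op WalkingSpan.left)) (limit.π D (op WalkingSpan.right))
      (D.map WalkingSpan.Hom.fst.op) (D.map WalkingSpan.Hom.snd.op) := by
  have w := (limit.w D WalkingSpan.Hom.fst.op).trans (limit.w D WalkingSpan.Hom.snd.op).symm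
  let cone : ∀ {T : C} (a : T ⟶ D.obj (op .left)) (b : T ⟶ D.obj (op .right))
      (_ : a ≫ D.map WalkingSpan.Hom.fst.op = b ≫ D.map WalkingSpan.Hom.snd.op), Cone D :=
    fun {T} a b hab =>
    { pt := T
      π :=
        { app := fun k => match k with
            | ⟨.left⟩ => a
            | ⟨.right⟩ => b
            | ⟨.zero⟩ => a ≫ D.map WalkingSpan.Hom.fst.op
          naturality := by
            rintro ⟨k⟩ ⟨l⟩ ⟨f⟩
            match k, l, f with
            | _, _, .id _ =>
              exact (Category.id_comp _).trans
                ((Category.comp_id _).symm.trans (congr(_ ≫ $((D.map_id _).symm))))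
            | _, _, .init .left => exact (Category.id_comp _)
            | _, _, .init .right => exact (Category.id_comp _).trans hab } }
  refine ⟨⟨w⟩, ⟨PullbackCone.IsLimit.mk w
    (fun s => limit.lift D (cone s.fst s.snd s.condition)) ?_ ?_ ?_⟩⟩
  · intro s
    exact limit.lift_π _ _
  · intro s
    exact limit.lift_π _ _
  · intro s m hl hr
    apply limit.hom_ext
    rintro ⟨k⟩
    rw [limit.lift_π]
    match k with
    | .left => exact hl
    | .right => exact hr
    | .zero =>
      rw [← limit.w D WalkingSpan.Hom.fst.op, ← Category.assoc, hl]

end CategoryTheory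

namespace AlgebraicGeometry

namespace PresheafedSpace

open Limits

/-- The sections of a push-out of presheafed spaces over an open set form a fibre product. -/
lemma isPullback_app_colimit (F : WalkingSpan ⥤ PresheafedSpace.{_, _, u} CommRingCat.{u})
    (O : Opens ↑(Limits.colimit F : PresheafedSpace CommRingCat))
    (e : op ((Opens.map (F.map WalkingSpan.Hom.snd).base).obj
        ((Opens.map (colimit.ι F .right).base).obj O)) =
      op ((Opens.map (F.map WalkingSpan.Hom.fst).base).obj
        ((Opens.map (colimit.ι F .left).base).obj O))) :
    IsPullback ((colimit.ι F .left).c.app (op O)) ((colimit.ι F .right).c.app (op O))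
      ((F.map WalkingSpan.Hom.fst).c.app (op ((Opens.map (colimit.ι F .left).base).obj O)))
      ((F.map WalkingSpan.Hom.snd).c.app (op ((Opens.map (colimit.ι F .right).base).obj O)) ≫
        (F.obj .zero).presheaf.map (eqToHom e)) := by
  let D := componentwiseDiagram F O
  let E := colimitPresheafObjIsoComponentwiseLimit F O
  have e₀ : op ((Opens.map (F.map WalkingSpan.Hom.fst).base).obj
      ((Opens.map (colimit.ι F .left).base).obj O)) =
      op ((Opens.map (colimit.ι F .zero).base).obj O) := by
    rw [← colimit.w F WalkingSpan.Hom.fst, comp_base]; rfl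
  have hfst : D.map WalkingSpan.Hom.fst.op =
      (F.map WalkingSpan.Hom.fst).c.app (op ((Opens.map (colimit.ι F .left).base).obj O)) ≫
        (F.obj .zero).presheaf.map (eqToHom e₀) := rfl
  have hsnd : D.map WalkingSpan.Hom.snd.op =
      ((F.map WalkingSpan.Hom.snd).c.app (op ((Opens.map (colimit.ι F .right).base).obj O)) ≫
        (F.obj .zero).presheaf.map (eqToHom e)) ≫ (F.obj .zero).presheaf.map (eqToHom e₀) := by
    rw [Category.assoc, ← (F.obj .zero).presheaf.map_comp, eqToHom_trans]
    rfl
  have hEl : E.hom ≫ limit.π D (op .left) = (colimit.ι F .left).c.app (op O) :=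
    colimitPresheafObjIsoComponentwiseLimit_hom_π F O .left
  have hEr : E.hom ≫ limit.π D (op .right) = (colimit.ι F .right).c.app (op O) :=
    colimitPresheafObjIsoComponentwiseLimit_hom_π F O .right
  refine (isPullback_limit_walkingSpan_op D).of_iso E.symm (Iso.refl _) (Iso.refl _)
    (asIso ((F.obj .zero).presheaf.map (eqToHom e₀))).symm ?_ ?_ ?_ ?_
  · rw [← hEl]
    exact (Category.comp_id _).trans (E.inv_hom_id_assoc _).symm
  · rw [← hEr]
    exact (Category.comp_id _).trans (E.inv_hom_id_assoc _).symm
  · refine (Iso.comp_inv_eq _).mpr (Eq.trans hfst ?_)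
    exact (Category.id_comp _).symm
  · refine (Iso.comp_inv_eq _).mpr (Eq.trans hsnd ?_)
    exact (Category.id_comp _).symm

lemma isPullback_app_of_isPushout {Z X V P : PresheafedSpace.{_, _, u} CommRingCat.{u}}
    {i : Z ⟶ X} {g : Z ⟶ V} {p : X ⟶ P} {j : V ⟶ P} (h : IsPushout i g p j) (O : Opens P)
    (e : op ((Opens.map g.base).obj ((Opens.map j.base).obj O)) =
      op ((Opens.map i.base).obj ((Opens.map p.base).obj O))) :
    IsPullback (p.c.app (op O)) (j.c.app (op O))
      (i.c.app (op ((Opens.map p.base).obj O)))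
      (g.c.app (op ((Opens.map j.base).obj O)) ≫ Z.presheaf.map (eqToHom e)) := by
  obtain ⟨E, hp, hj⟩ : ∃ E : Limits.colimit (span i g) ≅ P,
      p = colimit.ι (span i g) WalkingSpan.left ≫ E.hom ∧
      j = colimit.ι (span i g) WalkingSpan.right ≫ E.hom :=
    ⟨h.isoPushout.symm, h.inl_isoPushout_inv.symm, h.inr_isoPushout_inv.symm⟩
  subst hp hj
  have H := isPullback_app_colimit (span i g) ((Opens.map E.hom.base).obj O) e
  have := PresheafedSpace.c_isIso_of_iso E.hom
  have : IsIso (E.hom.c.app (op O)) := NatIso.isIso_app_of_isIso _ _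
  exact H.of_iso (asIso (E.hom.c.app (op O))).symm (Iso.refl _) (Iso.refl _) (Iso.refl _)
    ((Category.comp_id _).trans ((Iso.eq_inv_comp _).mpr rfl))
    ((Category.comp_id _).trans ((Iso.eq_inv_comp _).mpr rfl))
    ((Category.comp_id _).trans (Category.id_comp _).symm)
    ((Category.comp_id _).trans (Category.id_comp _).symm)

end PresheafedSpace

namespace LocallyRingedSpace

variable {Z X V P : LocallyRingedSpace.{u}} {i : Z ⟶ X} {g : Z ⟶ V} {p : X ⟶ P} {j : V ⟶ P}

lemma isPushout_toPresheafedSpace (h : IsPushout i g p j) :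
    IsPushout (C := PresheafedSpace.{_, _, u} CommRingCat.{u}) i.toHom g.toHom p.toHom j.toHom :=
  h.map (forgetToSheafedSpace ⋙ SheafedSpace.forgetToPresheafedSpace)

lemma isPushout_base (h : IsPushout i g p j) :
    IsPushout i.base g.base p.base j.base :=
  (isPushout_toPresheafedSpace h).map (PresheafedSpace.forget _)

lemma isPullback_app_of_isPushout (h : IsPushout i g p j) (O : Opens P)
    (e : op ((Opens.map g.base).obj ((Opens.map j.base).obj O)) =
      op ((Opens.map i.base).obj ((Opens.map p.base).obj O))) :
    IsPullback (p.c.app (op O)) (j.c.app (op O))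
      (i.c.app (op ((Opens.map p.base).obj O)))
      (g.c.app (op ((Opens.map j.base).obj O)) ≫ Z.presheaf.map (eqToHom e)) :=
  PresheafedSpace.isPullback_app_of_isPushout (isPushout_toPresheafedSpace h) O e

end LocallyRingedSpace

end AlgebraicGeometry

end LRSPushout

/-! ### The spectrum of a Milnor square -/

section SpecMilnor

open PrimeSpectrum

namespace IsMilnorSquare

variable {R A B C : Type*} [CommRing R] [CommRing A] [CommRing B] [CommRing C]
  [Algebra R A] [Algebra R B] [Algebra R C] [Algebra A C] [Algebra B C]
  [IsScalarTower R A C] [IsScalarTower R B C]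

lemma exists_comap_eq (h : IsMilnorSquare R A B C) (q : PrimeSpectrum R) :
    (∃ p, comap (algebraMap R A) p = q) ∨ ∃ p, comap (algebraMap R B) p = q := by
  rcases h.exists_algHom_of_field q.asIdeal.ResidueField with ⟨⟨f⟩⟩ | ⟨⟨f⟩⟩
  · refine .inl ⟨comap f.toRingHom ⊥, ?_⟩
    rw [← comap_comp_apply, show f.toRingHom.comp (algebraMap R A) = algebraMap R _ from
      f.comp_algebraMap]
    ext1
    exact Ideal.ker_algebraMap_residueField q.asIdeal
  · refine .inr ⟨comap f.toRingHom ⊥, ?_⟩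
    rw [← comap_comp_apply, show f.toRingHom.comp (algebraMap R B) = algebraMap R _ from
      f.comp_algebraMap]
    ext1
    exact Ideal.ker_algebraMap_residueField q.asIdeal

/-- Modulo the kernel of `A → C`, which is contained in `R`, the ring `A` is a quotient of the
integral `B`-algebra `C`, and `R → B` is surjective. -/
lemma isIntegral (h : IsMilnorSquare R A B C) [Algebra.IsIntegral B C] :
    Algebra.IsIntegral R A := by
  refine ⟨fun a => ?_⟩
  obtain ⟨f, hf, hfa⟩ := Algebra.IsIntegral.isIntegral (R := B) (algebraMap A C a)
  obtain ⟨F, hF, hFm⟩ : ∃ F : Polynomial R, F.map (algebraMap R B) = f ∧ F.Monic := by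
    have := Polynomial.lifts_and_natDegree_eq_and_monic (f := algebraMap R B)
      (p := f) ((Polynomial.mem_lifts _).mpr (Polynomial.map_surjective _ h.surjective_right f)) hf
    obtain ⟨F, hF, -, hFm⟩ := this
    exact ⟨F, hF, hFm⟩
  obtain ⟨r, hr, -⟩ := h.exists_lift_of_mem_ker (a := Polynomial.aeval a (F * Polynomial.X)) <| by
    rw [RingHom.mem_ker, ← Polynomial.aeval_algebraMap_apply, map_mul, Polynomial.aeval_def,
      IsScalarTower.algebraMap_eq R B C, ← Polynomial.eval₂_map, hF, hfa, zero_mul]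
  have h1 : _root_.IsIntegral R (Polynomial.aeval a (F * Polynomial.X)) :=
    hr ▸ isIntegral_algebraMap
  by_cases hR : Nontrivial R
  · exact IsIntegral.of_aeval_monic (hFm.mul Polynomial.monic_X)
      (by rw [hFm.natDegree_mul Polynomial.monic_X, Polynomial.natDegree_X]; omega) h1
  · have := not_nontrivial_iff_subsingleton.mp hR
    have := Module.subsingleton R A
    exact Subsingleton.elim a 0 ▸ isIntegral_zero

/-- Away from the closed subset `Spec C` of `Spec A`, the map `Spec A → Spec R` is injective. -/
lemma eq_of_comap_eq (h : IsMilnorSquare R A B C) {p p' : PrimeSpectrum A}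
    (hp : ¬ RingHom.ker (algebraMap A C) ≤ p.asIdeal)
    (hpp : comap (algebraMap R A) p = comap (algebraMap R A) p') : p = p' := by
  have hmem (r : R) : algebraMap R A r ∈ p.asIdeal ↔ algebraMap R A r ∈ p'.asIdeal := by
    have := congr(r ∈ PrimeSpectrum.asIdeal $hpp)
    exact iff_of_eq this
  obtain ⟨f, hf, hfp⟩ := SetLike.not_le_iff_exists.mp hp
  have key : ∀ a : A, ∃ r : R, algebraMap R A r = a * f := fun a => by
    obtain ⟨r, hr, -⟩ := h.exists_lift_of_mem_ker (Ideal.mul_mem_left _ a hf)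
    exact ⟨r, hr⟩
  have hfp' : f ∉ p'.asIdeal := by
    obtain ⟨r, hr⟩ := key 1
    rw [one_mul] at hr
    rwa [← hr, ← hmem, hr]
  ext a
  obtain ⟨r, hr⟩ := key a
  rw [← (p.2.mul_mem_right_iff hfp), ← (p'.2.mul_mem_right_iff hfp'), ← hr, hmem]

lemma ker_le_of_comap_eq (h : IsMilnorSquare R A B C) {p : PrimeSpectrum A} {q : PrimeSpectrum B}
    (hpq : comap (algebraMap R A) p = comap (algebraMap R B) q) :
    RingHom.ker (algebraMap A C) ≤ p.asIdeal := by
  intro a ha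
  obtain ⟨r, hr, hr0⟩ := h.exists_lift_of_mem_ker ha
  have : algebraMap R A r ∈ p.asIdeal ↔ algebraMap R B r ∈ q.asIdeal :=
    iff_of_eq congr(r ∈ PrimeSpectrum.asIdeal $hpq)
  rw [← hr, this, hr0]
  exact zero_mem _

/-- A space glued from `Spec A` and `Spec B` along `Spec C` is homeomorphic to `Spec R`. -/
lemma isHomeomorph_of_comp_eq_comap (h : IsMilnorSquare R A B C) [Algebra.IsIntegral B C]
    {Y : Type*} [TopologicalSpace Y] {a : PrimeSpectrum A → Y} {b : PrimeSpectrum B → Y}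
    {π : Y → PrimeSpectrum R} (ha : Continuous a) (hb : Continuous b) (hπ : Continuous π)
    (hab : ∀ c, a (comap (algebraMap A C) c) = b (comap (algebraMap B C) c))
    (hs : ∀ y, (∃ p, a p = y) ∨ ∃ q, b q = y)
    (hπa : ∀ p, π (a p) = comap (algebraMap R A) p)
    (hπb : ∀ q, π (b q) = comap (algebraMap R B) q) : IsHomeomorph π := by
  have := h.isIntegral
  have hinjB : Function.Injective (comap (algebraMap R B)) :=
    comap_injective_of_surjective _ h.surjective_right
  -- a point of `Spec A` either lies outside of `Spec C`, or comes from `Spec B`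
  have key (p : PrimeSpectrum A) (hp : RingHom.ker (algebraMap A C) ≤ p.asIdeal) :
      ∃ q, a p = b q := by
    obtain ⟨c, rfl⟩ : p ∈ Set.range (comap (algebraMap A C)) := by
      rw [range_comap_of_surjective _ _ h.surjective]
      exact hp
    exact ⟨_, hab c⟩
  have hBB (q q' : PrimeSpectrum B) (e : π (b q) = π (b q')) : b q = b q' := by
    rw [hπb, hπb] at e
    rw [hinjB e]
  have hAB (p : PrimeSpectrum A) (q : PrimeSpectrum B) (e : π (a p) = π (b q)) : a p = b q := by
    obtain ⟨q', hq'⟩ := key p (h.ker_le_of_comap_eq (q := q) (by rw [← hπa, e, hπb]))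
    rw [hq'] at e ⊢
    exact hBB _ _ e
  have hAA (p p' : PrimeSpectrum A) (e : π (a p) = π (a p')) : a p = a p' := by
    by_cases hp : RingHom.ker (algebraMap A C) ≤ p.asIdeal
    · obtain ⟨q', hq'⟩ := key p hp
      rw [hq'] at e ⊢
      exact (hAB p' q' e.symm).symm
    · rw [h.eq_of_comap_eq hp (p' := p') (by rw [← hπa, e, hπa])]
  refine isHomeomorph_iff_continuous_isClosedMap_bijective.mpr ⟨hπ, ?_, ?_, ?_⟩
  · intro F hF
    have : π '' F = comap (algebraMap R A) '' (a ⁻¹' F) ∪ comap (algebraMap R B) '' (b ⁻¹' F) := by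
      ext x
      constructor
      · rintro ⟨y, hy, rfl⟩
        rcases hs y with ⟨p, rfl⟩ | ⟨q, rfl⟩
        · exact .inl ⟨p, hy, (hπa p).symm⟩
        · exact .inr ⟨q, hy, (hπb q).symm⟩
      · rintro (⟨p, hp, rfl⟩ | ⟨q, hq, rfl⟩)
        · exact ⟨_, hp, hπa p⟩
        · exact ⟨_, hq, hπb q⟩
    rw [this]
    exact (isClosedMap_comap_of_isIntegral _ (algebraMap_isIntegral_iff.mpr ‹_›) _
        (hF.preimage ha)).union
      ((isClosedEmbedding_comap_of_surjective _ _ h.surjective_right).isClosedMap _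
        (hF.preimage hb))
  · intro y y' e
    rcases hs y with ⟨p, rfl⟩ | ⟨q, rfl⟩ <;> rcases hs y' with ⟨p', rfl⟩ | ⟨q', rfl⟩
    · exact hAA _ _ e
    · exact hAB _ _ e
    · exact (hAB _ _ e.symm).symm
    · exact hBB _ _ e
  · intro x
    rcases h.exists_comap_eq x with ⟨p, rfl⟩ | ⟨q, rfl⟩
    · exact ⟨_, hπa p⟩
    · exact ⟨_, hπb q⟩

end IsMilnorSquare

/-- Localization away from an element commutes with fibre products of rings. -/
lemma CommRingCat.isLocalization_away_of_isPullback {R A B C R' A' B' C' : CommRingCat.{u}}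
    {rA : R ⟶ A} {rB : R ⟶ B} {α : A ⟶ C} {β : B ⟶ C}
    {rA' : R' ⟶ A'} {rB' : R' ⟶ B'} {α' : A' ⟶ C'} {β' : B' ⟶ C'}
    (h : IsPullback rA rB α β) (h' : IsPullback rA' rB' α' β')
    (φR : R ⟶ R') (φA : A ⟶ A') (φB : B ⟶ B') (φC : C ⟶ C')
    (wA : rA ≫ φA = φR ≫ rA') (wB : rB ≫ φB = φR ≫ rB')
    (wα : α ≫ φC = φA ≫ α') (wβ : β ≫ φC = φB ≫ β') (f : R)
    (hA : @IsLocalization.Away _ _ (rA f) A' _ φA.hom.toAlgebra)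
    (hB : @IsLocalization.Away _ _ (rB f) B' _ φB.hom.toAlgebra)
    (hC : @IsLocalization.Away _ _ (α (rA f)) C' _ φC.hom.toAlgebra) :
    @IsLocalization.Away _ _ f R' _ φR.hom.toAlgebra := by
  let := φR.hom.toAlgebra
  let := φA.hom.toAlgebra
  let := φB.hom.toAlgebra
  let := φC.hom.toAlgebra
  have wA (r : R) : φA (rA r) = rA' (φR r) := congr($wA r)
  have wB (r : R) : φB (rB r) = rB' (φR r) := congr($wB r)
  have wα (r : A) : φC (α r) = α' (φA r) := congr($wα r)
  have wβ (r : B) : φC (β r) = β' (φB r) := congr($wβ r)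
  have w (r : R) : α (rA r) = β (rB r) := congr($(h.w) r)
  have w' (r : R') : α' (rA' r) = β' (rB' r) := congr($(h'.w) r)
  have ext' {r s : R'} := CommRingCat.ext_of_isPullback h' (r := r) (s := s)
  have uA : IsUnit (φA (rA f)) := IsLocalization.Away.algebraMap_isUnit (rA f)
  have uB : IsUnit (φB (rB f)) := IsLocalization.Away.algebraMap_isUnit (rB f)
  refine IsLocalization.Away.mk _ ?_ ?_ ?_
  · obtain ⟨a, ha⟩ := isUnit_iff_exists_inv.mp uA
    obtain ⟨b, hb⟩ := isUnit_iff_exists_inv.mp uB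
    have hab : α' a = β' b := by
      have h1 := congr(α' $ha)
      have h2 := congr(β' $hb)
      rw [map_mul, wA, w', ← wB, map_one] at h1
      rw [map_mul, map_one] at h2
      exact (inv_unique h1 h2)
    obtain ⟨s, hs, hs'⟩ := CommRingCat.exists_of_isPullback h' a b hab
    refine isUnit_iff_exists_inv.mpr ⟨s, ext' ?_ ?_⟩
    · change rA' (φR f * s) = _
      rw [map_mul, ← wA, hs, ha, map_one]
    · change rB' (φR f * s) = _
      rw [map_mul, ← wB, hs', hb, map_one]
  · intro s
    obtain ⟨n, a, ha⟩ := IsLocalization.Away.surj (rA f) (rA' s)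
    obtain ⟨m, b, hb⟩ := IsLocalization.Away.surj (rB f) (rB' s)
    change rA' s * φA (rA f) ^ n = φA a at ha
    change rB' s * φB (rB f) ^ m = φB b at hb
    have hc : φC (α (a * rA f ^ m)) = φC (β (b * rB f ^ n)) := by
      have e₁ : φC (α a) = β' (rB' s) * β' (rB' (φR f)) ^ n := by
        rw [wα, ← ha, map_mul, map_pow, wA, w', w']
      have e₂ : φC (β b) = β' (rB' s) * β' (rB' (φR f)) ^ m := by
        rw [wβ, ← hb, map_mul, map_pow, wB]
      simp only [map_mul, map_pow, e₁, e₂, wα, wβ, wA, wB, w']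
      ring
    obtain ⟨k, hk⟩ := IsLocalization.Away.exists_of_eq (α (rA f)) hc
    obtain ⟨r, hr, hr'⟩ := CommRingCat.exists_of_isPullback h (rA f ^ k * (a * rA f ^ m))
      (rB f ^ k * (b * rB f ^ n)) (by
        simp only [map_mul, map_pow, ← w] at hk ⊢
        linear_combination hk)
    refine ⟨n + m + k, r, ext' ?_ ?_⟩
    · change rA' (s * φR f ^ (n + m + k)) = rA' (φR r)
      rw [← wA, hr, map_mul, map_mul, map_mul, ← ha]
      simp only [map_pow, wA]
      ring
    · change rB' (s * φR f ^ (n + m + k)) = rB' (φR r)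
      rw [← wB, hr', map_mul, map_mul, map_mul, ← hb]
      simp only [map_pow, wB]
      ring
  · intro r s hrs
    change φR r = φR s at hrs
    obtain ⟨n, hn⟩ := IsLocalization.Away.exists_of_eq (S := A') (rA f) (a := rA r) (b := rA s)
      (show φA _ = φA _ by rw [wA, wA, hrs])
    obtain ⟨m, hm⟩ := IsLocalization.Away.exists_of_eq (S := B') (rB f) (a := rB r) (b := rB s)
      (show φB _ = φB _ by rw [wB, wB, hrs])
    refine ⟨m + n, CommRingCat.ext_of_isPullback h ?_ ?_⟩
    · simp only [map_mul, map_pow, pow_add]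
      linear_combination (rA f) ^ m * hn
    · simp only [map_mul, map_pow, pow_add]
      linear_combination (rB f) ^ n * hm

end SpecMilnor

/-! ### A criterion for a locally ringed space to be affine -/

section AffineCriterion

open Opposite TopologicalSpace Topology

namespace AlgebraicGeometry.LocallyRingedSpace

lemma isIso_of_isIso_base_of_isIso_c {X Y : LocallyRingedSpace.{u}} (f : X ⟶ Y)
    (h₁ : IsIso f.base) (h₂ : IsIso f.c) : IsIso f := by
  have : IsIso (C := PresheafedSpace CommRingCat) f.toHom :=
    PresheafedSpace.isIso_of_components (f.toHom : X.toPresheafedSpace ⟶ Y.toPresheafedSpace)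
  have : IsIso (SheafedSpace.forgetToPresheafedSpace.map (forgetToSheafedSpace.map f)) := this
  have := isIso_of_reflects_iso (forgetToSheafedSpace.map f) SheafedSpace.forgetToPresheafedSpace
  exact isIso_of_reflects_iso f forgetToSheafedSpace

/-- A locally ringed space is affine as soon as its map to the spectrum of its global sections is a
homeomorphism and the sections over each basic open subset are the expected localization. -/
lemma isIso_toΓSpec (Q : LocallyRingedSpace.{u}) (h₁ : IsHomeomorph Q.toΓSpecFun)
    (h₂ : ∀ r : Q.presheaf.obj (op ⊤), @IsLocalization.Away _ _ r
      (Q.presheaf.obj (op (Q.toRingedSpace.basicOpen r))) _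
      (Q.presheaf.map (homOfLE le_top).op).hom.toAlgebra) : IsIso Q.toΓSpec := by
  apply isIso_of_isIso_base_of_isIso_c
  · exact (TopCat.isIso_iff_isHomeomorph _).mpr h₁
  · have H (r : Q.presheaf.obj (op ⊤)) : IsIso (Q.toΓSpec.c.app (op (PrimeSpectrum.basicOpen r))) := by
      have : Q.toΓSpec.c.app (op (PrimeSpectrum.basicOpen r)) = Q.toΓSpecCApp r :=
        Q.toΓSpecSheafedSpace_app_eq r
      rw [this]
      have hloc : ∀ (D : Opens Q) (_ : D = Q.toRingedSpace.basicOpen r),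
          @IsLocalization.Away _ _ r (Q.presheaf.obj (op D)) _
            (Q.presheaf.map (homOfLE le_top).op).hom.toAlgebra := by
        rintro _ rfl
        exact h₂ r
      let := (Q.presheaf.map (homOfLE le_top : Q.toΓSpecMapBasicOpen r ⟶ ⊤).op).hom.toAlgebra
      have := hloc _ (Q.toΓSpecMapBasicOpen_eq r)
      let : Algebra (Q.presheaf.obj (op ⊤)) ((Spec.structureSheaf (Q.presheaf.obj (op ⊤))).obj.obj
          (op (PrimeSpectrum.basicOpen r))) :=
        StructureSheaf.openAlgebra _ (op (PrimeSpectrum.basicOpen r))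
      have : IsLocalization (Submonoid.powers r) ((Spec.structureSheaf
          (Q.presheaf.obj (op ⊤))).obj.obj (op (PrimeSpectrum.basicOpen r))) :=
        StructureSheaf.IsLocalization.to_basicOpen (Q.presheaf.obj (op ⊤)) r
      refine (ConcreteCategory.isIso_iff_bijective _).mpr ?_
      exact IsLocalization.bijective (R := Q.presheaf.obj (op ⊤))
        (S := (Spec.structureSheaf (Q.presheaf.obj (op ⊤))).obj.obj
          (op (PrimeSpectrum.basicOpen r)))
        (Q := Q.presheaf.obj (op (Q.toΓSpecMapBasicOpen r)))
        (Submonoid.powers r) (Q.toΓSpecCApp r).hom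
        (congrArg CommRingCat.Hom.hom (Q.toΓSpecCApp_spec r))
    let φ : (Spec.structureSheaf (Q.presheaf.obj (op ⊤))) ⟶
      (TopCat.Sheaf.pushforward _ Q.toΓSpecBase).obj Q.𝒪 := ⟨Q.toΓSpec.c⟩
    have : IsIso φ := TopCat.Sheaf.isIso_iff_isIso_basis PrimeSpectrum.isBasis_basic_opens H
    exact Functor.map_isIso (TopCat.Sheaf.forget _ _) φ

lemma functor_obj_basicOpen_restrict (P : LocallyRingedSpace.{u}) {Y : TopCat.{u}}
    {f : Y ⟶ P.toTopCat} (h : IsOpenEmbedding f) (D : Opens Y)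
    (r : (P.restrict h).presheaf.obj (op D)) :
    h.functor.obj ((P.restrict h).toRingedSpace.basicOpen r) =
      P.toRingedSpace.basicOpen (U := h.functor.obj D) r := by
  have hle := P.toRingedSpace.basicOpen_le (U := h.functor.obj D) r
  apply le_antisymm
  · rintro _ ⟨x, hx, rfl⟩
    have hu : IsUnit (P.presheaf.map (h.functor.map (homOfLE
        ((P.restrict h).toRingedSpace.basicOpen_le r))).op r) :=
      (P.restrict h).toRingedSpace.isUnit_res_basicOpen r
    have hxm : f x ∈ h.functor.obj ((P.restrict h).toRingedSpace.basicOpen r) := ⟨x, hx, rfl⟩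
    have := P.toRingedSpace.basicOpen_of_isUnit hu
    have e := P.toRingedSpace.basicOpen_res (U := op (h.functor.obj D))
      (h.functor.map (homOfLE ((P.restrict h).toRingedSpace.basicOpen_le r))).op r
    exact ((e.symm.trans this).ge hxm).2
  · intro y hy
    obtain ⟨x, hx, rfl⟩ := hle hy
    refine ⟨x, ?_, rfl⟩
    let D' : Opens Y := (Opens.map f).obj (P.toRingedSpace.basicOpen (U := h.functor.obj D) r)
    have hD' : D' ≤ D := fun z hz => by
      obtain ⟨z', hz', e⟩ := hle hz
      exact h.injective e ▸ hz'
    have hle' : h.functor.obj D' ≤ P.toRingedSpace.basicOpen (U := h.functor.obj D) r := by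
      rintro _ ⟨z, hz, rfl⟩
      exact hz
    have hu : IsUnit ((P.restrict h).presheaf.map (homOfLE hD').op r) := by
      have := (P.toRingedSpace.isUnit_res_basicOpen (U := h.functor.obj D) r).map
        (P.presheaf.map (homOfLE hle').op).hom
      erw [← CommRingCat.comp_apply, ← Functor.map_comp] at this
      exact this
    have := (P.restrict h).toRingedSpace.basicOpen_of_isUnit hu
    have e := (P.restrict h).toRingedSpace.basicOpen_res (U := op D) (homOfLE hD').op r
    exact ((e.symm.trans this).ge hy).2

end AlgebraicGeometry.LocallyRingedSpace

end AffineCriterion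

/-! ### Affine open subsets of a push-out -/

section PushoutAffine

open Opposite TopologicalSpace Topology

namespace AlgebraicGeometry

/-- The preimage of an open subset under a morphism from a scheme to a locally ringed space. -/
abbrev LocallyRingedSpace.preimageOpens {X : Scheme.{u}} {P : LocallyRingedSpace.{u}}
    (p : X.toLocallyRingedSpace ⟶ P) (O : Opens P) : X.Opens :=
  (Opens.map p.base).obj O

namespace LocallyRingedSpace

variable {X Z V : Scheme.{u}} {P : LocallyRingedSpace.{u}} {i : Z ⟶ X} {g : Z ⟶ V}
  {p : X.toLocallyRingedSpace ⟶ P} {j : V.toLocallyRingedSpace ⟶ P}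

lemma preimage_preimageOpens_eq (h : IsPushout i.toLRSHom g.toLRSHom p j) (O : Opens P) :
    i ⁻¹ᵁ preimageOpens p O = g ⁻¹ᵁ preimageOpens j O :=
  congrArg (fun f : Z.toLocallyRingedSpace ⟶ P => (Opens.map f.base).obj O) h.w

/-- Sections of a push-out are pairs of sections that agree on `Z`. -/
lemma isPullback_c_app (h : IsPushout i.toLRSHom g.toLRSHom p j) (O : Opens P) :
    IsPullback (p.c.app (op O)) (j.c.app (op O)) (i.app (preimageOpens p O))
      (g.appLE (preimageOpens j O) (i ⁻¹ᵁ preimageOpens p O)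
        (preimage_preimageOpens_eq h O).le) :=
  isPullback_app_of_isPushout h O congr(op $((preimage_preimageOpens_eq h O).symm))

lemma mem_range_of_isPushout (h : IsPushout i.toLRSHom g.toLRSHom p j) (y : P) :
    (∃ x, p.base x = y) ∨ ∃ v, j.base v = y :=
  TopCat.mem_range_of_isPushout (isPushout_base h) y

lemma exists_opens_of_isPushout (h : IsPushout i.toLRSHom g.toLRSHom p j) (W : X.Opens)
    (U : V.Opens) (hWU : i ⁻¹ᵁ W = g ⁻¹ᵁ U) :
    ∃ O : Opens P, preimageOpens p O = W ∧ preimageOpens j O = U :=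
  TopCat.exists_opens_of_isPushout (isPushout_base h) W U hWU

lemma preimageOpens_basicOpen (p : X.toLocallyRingedSpace ⟶ P) {O : Opens P}
    (r : P.presheaf.obj (op O)) :
    preimageOpens p (P.toRingedSpace.basicOpen r) = X.basicOpen (p.c.app (op O) r) :=
  preimage_basicOpen p r

variable {O : Opens P}

/-- Sections over an open subset of the push-out are a fiber product of sections over its preimages,
and localization is compatible with fiber products. -/
lemma isLocalization_basicOpen_of_isPushout [IsAffineHom i]
    (h : IsPushout i.toLRSHom g.toLRSHom p j)
    (hW : IsAffineOpen (preimageOpens p O)) (hU : IsAffineOpen (preimageOpens j O))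
    (r : P.presheaf.obj (op O)) :
    @IsLocalization.Away _ _ r (P.presheaf.obj (op (P.toRingedSpace.basicOpen r))) _
      (P.presheaf.map (homOfLE (P.toRingedSpace.basicOpen_le r)).op).hom.toAlgebra := by
  have hO := P.toRingedSpace.basicOpen_le r
  have hp : preimageOpens p (P.toRingedSpace.basicOpen r) ≤ preimageOpens p O :=
    fun x hx => hO hx
  have hj : preimageOpens j (P.toRingedSpace.basicOpen r) ≤ preimageOpens j O :=
    fun x hx => hO hx
  have hi : i ⁻¹ᵁ preimageOpens p (P.toRingedSpace.basicOpen r) ≤ i ⁻¹ᵁ preimageOpens p O :=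
    fun x hx => hO hx
  refine CommRingCat.isLocalization_away_of_isPullback (isPullback_c_app h O)
    (isPullback_c_app h (P.toRingedSpace.basicOpen r)) _
    (X.presheaf.map (homOfLE hp).op) (V.presheaf.map (homOfLE hj).op)
    (Z.presheaf.map (homOfLE hi).op) ?_ ?_ ?_ ?_ r ?_ ?_ ?_
  · exact (p.c.naturality _).symm
  · exact (j.c.naturality _).symm
  · exact (i.naturality _).symm
  · simp
  · exact hW.isLocalization_of_eq_basicOpen _ _ (preimageOpens_basicOpen p r)
  · exact hU.isLocalization_of_eq_basicOpen _ _ (preimageOpens_basicOpen j r)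
  · refine (hW.preimage i).isLocalization_of_eq_basicOpen _ _ ?_
    rw [preimageOpens_basicOpen, Scheme.preimage_basicOpen]

lemma isIntegral_appLE_of_eq (g : Z ⟶ V) [IsIntegralHom g] {U : V.Opens} (hU : IsAffineOpen U)
    {T : Z.Opens} (e : T = g ⁻¹ᵁ U) : (g.appLE U T e.le).hom.IsIntegral := by
  subst e
  rw [g.appLE_eq_app]
  exact g.isIntegral_app U hU

lemma isMilnorSquare_of_isPushout [IsClosedImmersion i]
    (h : IsPushout i.toLRSHom g.toLRSHom p j) (hW : IsAffineOpen (preimageOpens p O)) :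
    letI : Algebra (P.presheaf.obj (op O)) Γ(X, preimageOpens p O) :=
      (p.c.app (op O)).hom.toAlgebra
    letI : Algebra (P.presheaf.obj (op O)) Γ(V, preimageOpens j O) :=
      (j.c.app (op O)).hom.toAlgebra
    letI := (i.app (preimageOpens p O)).hom.toAlgebra
    letI := (g.appLE (preimageOpens j O) (i ⁻¹ᵁ preimageOpens p O)
      (preimage_preimageOpens_eq h O).le).hom.toAlgebra
    IsMilnorSquare (P.presheaf.obj (op O)) Γ(X, preimageOpens p O) Γ(V, preimageOpens j O)
      Γ(Z, i ⁻¹ᵁ preimageOpens p O) := by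
  let : Algebra (P.presheaf.obj (op O)) Γ(X, preimageOpens p O) :=
      (p.c.app (op O)).hom.toAlgebra
  let : Algebra (P.presheaf.obj (op O)) Γ(V, preimageOpens j O) :=
      (j.c.app (op O)).hom.toAlgebra
  let := (i.app (preimageOpens p O)).hom.toAlgebra
  let := (g.appLE (preimageOpens j O) (i ⁻¹ᵁ preimageOpens p O)
    (preimage_preimageOpens_eq h O).le).hom.toAlgebra
  have hP := isPullback_c_app h O
  exact
    { surjective := i.app_surjective _ hW
      eq_zero := fun r hA hB => CommRingCat.ext_of_isPullback hP
        (hA.trans (map_zero (p.c.app (op O)).hom).symm)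
        (hB.trans (map_zero (j.c.app (op O)).hom).symm)
      exists_lift := fun a b hab => CommRingCat.exists_of_isPullback hP a b hab }

lemma fromSpec_mem_basicOpen_iff (p : X.toLocallyRingedSpace ⟶ P)
    (hW : IsAffineOpen (preimageOpens p O)) (q : Spec Γ(X, preimageOpens p O))
    (r : P.presheaf.obj (op O)) :
    p.base (hW.fromSpec q) ∈ P.toRingedSpace.basicOpen r ↔
      p.c.app (op O) r ∉ PrimeSpectrum.asIdeal q := by
  change hW.fromSpec q ∈ preimageOpens p (P.toRingedSpace.basicOpen r) ↔ _
  rw [preimageOpens_basicOpen]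
  exact iff_of_eq congr(q ∈ $(hW.fromSpec_preimage_basicOpen (p.c.app (op O) r)))

lemma notMem_toΓSpecFun_restrict_iff (O : Opens P)
    (r : P.presheaf.obj (op (O.isOpenEmbedding.functor.obj ⊤))) (x : O) :
    r ∉ ((P.restrict O.isOpenEmbedding).toΓSpecFun x).asIdeal ↔
      x.1 ∈ P.toRingedSpace.basicOpen r := by
  have := functor_obj_basicOpen_restrict P O.isOpenEmbedding ⊤ r
  refine ((P.restrict O.isOpenEmbedding).notMem_prime_iff_unit_in_stalk r x).trans
    (((P.restrict O.isOpenEmbedding).toRingedSpace.mem_top_basicOpen r x).symm.trans ?_)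
  rw [← this]
  constructor
  · intro hx
    exact ⟨x, hx, rfl⟩
  · rintro ⟨y, hy, e⟩
    exact Subtype.ext e ▸ hy

/-- If the preimages of `O` in `X` and `V` are affine, then so is `O`. -/
lemma isIso_toΓSpec_restrict [IsClosedImmersion i] [IsIntegralHom g]
    (h : IsPushout i.toLRSHom g.toLRSHom p j)
    (hW : IsAffineOpen (preimageOpens p O)) (hU : IsAffineOpen (preimageOpens j O)) :
    IsIso (P.restrict O.isOpenEmbedding).toΓSpec := by
  let O' : Opens P := O.isOpenEmbedding.functor.obj ⊤
  have hO' : O' = O := O.isOpenEmbedding_obj_top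
  replace hW : IsAffineOpen (preimageOpens p O') := by rwa [hO']
  replace hU : IsAffineOpen (preimageOpens j O') := by rwa [hO']
  apply isIso_toΓSpec
  · let : Algebra (P.presheaf.obj (op O')) Γ(X, preimageOpens p O') :=
      (p.c.app (op O')).hom.toAlgebra
    let : Algebra (P.presheaf.obj (op O')) Γ(V, preimageOpens j O') :=
      (j.c.app (op O')).hom.toAlgebra
    let := (i.app (preimageOpens p O')).hom.toAlgebra
    let := (g.appLE (preimageOpens j O') (i ⁻¹ᵁ preimageOpens p O')
      (preimage_preimageOpens_eq h O').le).hom.toAlgebra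
    let : Algebra (P.presheaf.obj (op O')) Γ(Z, i ⁻¹ᵁ preimageOpens p O') :=
      (p.c.app (op O') ≫ i.app (preimageOpens p O')).hom.toAlgebra
    have hsq := isMilnorSquare_of_isPushout h hW
    have : IsScalarTower (P.presheaf.obj (op O')) Γ(X, preimageOpens p O')
      Γ(Z, i ⁻¹ᵁ preimageOpens p O') := .of_algebraMap_eq' rfl
    have : IsScalarTower (P.presheaf.obj (op O')) Γ(V, preimageOpens j O')
      Γ(Z, i ⁻¹ᵁ preimageOpens p O') := .of_algebraMap_eq'
        congr(($((isPullback_c_app h O').w)).hom)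
    have : Algebra.IsIntegral Γ(V, preimageOpens j O') Γ(Z, i ⁻¹ᵁ preimageOpens p O') :=
      algebraMap_isIntegral_iff.mp
        (isIntegral_appLE_of_eq g hU (preimage_preimageOpens_eq h O'))
    have hpO (q : Spec Γ(X, preimageOpens p O')) : p.base (hW.fromSpec q) ∈ O := by
      have : hW.fromSpec q ∈ (preimageOpens p O' : Set X) := hW.range_fromSpec ▸ ⟨q, rfl⟩
      exact hO'.le this
    have hjO (q : Spec Γ(V, preimageOpens j O')) : j.base (hU.fromSpec q) ∈ O := by
      have : hU.fromSpec q ∈ (preimageOpens j O' : Set V) := hU.range_fromSpec ▸ ⟨q, rfl⟩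
      exact hO'.le this
    refine hsq.isHomeomorph_of_comp_eq_comap
      (a := fun q : Spec Γ(X, preimageOpens p O') => (⟨p.base (hW.fromSpec q), hpO q⟩ : O))
      (b := fun q : Spec Γ(V, preimageOpens j O') => (⟨j.base (hU.fromSpec q), hjO q⟩ : O))
      ?_ ?_ (toΓSpec_continuous _) ?_ ?_ ?_ ?_
    · exact (p.base.hom.continuous.comp hW.fromSpec.continuous).subtype_mk _
    · exact (j.base.hom.continuous.comp hU.fromSpec.continuous).subtype_mk _
    · intro c
      apply Subtype.ext
      have e₁ := IsAffineOpen.SpecMap_appLE_fromSpec i hW (hW.preimage i) le_rfl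
      have e₂ := IsAffineOpen.SpecMap_appLE_fromSpec g hU (hW.preimage i)
        (preimage_preimageOpens_eq h O').le
      rw [i.appLE_eq_app] at e₁
      have e₁ : hW.fromSpec (Spec.map (i.app _) c) = i ((hW.preimage i).fromSpec c) :=
        congr($e₁ c)
      have e₂ : hU.fromSpec (Spec.map (g.appLE _ _ (preimage_preimageOpens_eq h O').le) c) =
        g ((hW.preimage i).fromSpec c) := congr($e₂ c)
      have e₃ : p.base (i ((hW.preimage i).fromSpec c)) = j.base (g ((hW.preimage i).fromSpec c)) :=
        congrArg (fun f : Z.toLocallyRingedSpace ⟶ P => f.base ((hW.preimage i).fromSpec c)) h.w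
      exact (congrArg p.base e₁).trans (e₃.trans (congrArg j.base e₂).symm)
    · rintro ⟨y, hy⟩
      rw [← hO'] at hy
      rcases mem_range_of_isPushout h y with ⟨x, rfl⟩ | ⟨v, rfl⟩
      · obtain ⟨q, rfl⟩ : x ∈ Set.range hW.fromSpec := hW.range_fromSpec ▸ hy
        exact .inl ⟨q, rfl⟩
      · obtain ⟨q, rfl⟩ : v ∈ Set.range hU.fromSpec := hU.range_fromSpec ▸ hy
        exact .inr ⟨q, rfl⟩
    · intro q
      ext r
      exact not_iff_not.mp ((notMem_toΓSpecFun_restrict_iff O r _).trans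
        (fromSpec_mem_basicOpen_iff p hW q r))
    · intro q
      ext r
      exact not_iff_not.mp ((notMem_toΓSpecFun_restrict_iff O r _).trans
        (fromSpec_mem_basicOpen_iff j hU q r))
  · intro r
    have key : ∀ (D : Opens P) (hD : D ≤ O') (_ : D = P.toRingedSpace.basicOpen r),
        @IsLocalization.Away _ _ r (P.presheaf.obj (op D)) _
          (P.presheaf.map (homOfLE hD).op).hom.toAlgebra := by
      rintro _ _ rfl
      exact isLocalization_basicOpen_of_isPushout h hW hU r
    exact key _ _ (functor_obj_basicOpen_restrict P O.isOpenEmbedding ⊤ r)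

end LocallyRingedSpace

end AlgebraicGeometry

end PushoutAffine

/-! ### Existence of affine neighbourhoods -/

section AffineNeighbourhoods

open Opposite TopologicalSpace Topology

/-- Prime avoidance: inside an open neighbourhood of finitely many points there is a basic open
neighbourhood of them. -/
lemma PrimeSpectrum.exists_basicOpen_le_of_finite {R : Type*} [CommRing R]
    {F : Set (PrimeSpectrum R)} (hF : F.Finite) {N : Opens (PrimeSpectrum R)} (hFN : F ⊆ N) :
    ∃ h : R, F ⊆ basicOpen h ∧ basicOpen h ≤ N := by
  rcases F.eq_empty_or_nonempty with rfl | ⟨a, ha⟩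
  · exact ⟨0, by simp, by simp⟩
  have hN : zeroLocus (vanishingIdeal ((N : Set (PrimeSpectrum R))ᶜ) : Set R) =
      (N : Set (PrimeSpectrum R))ᶜ := by
    rw [zeroLocus_vanishingIdeal_eq_closure, N.isOpen.isClosed_compl.closure_eq]
  have key : ¬ ((vanishingIdeal ((N : Set (PrimeSpectrum R))ᶜ) : Set R) ⊆
      ⋃ q ∈ (hF.toFinset : Set (PrimeSpectrum R)), (q.asIdeal : Set R)) := by
    rw [Ideal.subset_union_prime a a (fun q _ _ _ => q.2)]
    rintro ⟨q, hq, hq'⟩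
    have : q ∈ zeroLocus (vanishingIdeal ((N : Set (PrimeSpectrum R))ᶜ) : Set R) := hq'
    rw [hN] at this
    exact this (hFN (hF.mem_toFinset.mp hq))
  obtain ⟨h, hI, hF'⟩ := Set.not_subset.mp key
  refine ⟨h, fun q hq hq' => hF' ?_, fun q hq => ?_⟩
  · exact Set.mem_biUnion (hF.coe_toFinset.symm ▸ hq) hq'
  · by_contra hqN
    have : q ∈ zeroLocus (vanishingIdeal ((N : Set (PrimeSpectrum R))ᶜ) : Set R) := by
      rwa [hN]
    exact hq (this hI)

namespace AlgebraicGeometry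

lemma Scheme.exists_basicOpen_le_of_finite {X : Scheme.{u}} [IsAffine X] {F : Set X}
    (hF : F.Finite) {N : X.Opens} (hFN : F ⊆ N) :
    ∃ h : Γ(X, ⊤), F ⊆ X.basicOpen h ∧ X.basicOpen h ≤ N := by
  obtain ⟨h, h₁, h₂⟩ := PrimeSpectrum.exists_basicOpen_le_of_finite
    (F := X.isoSpec.inv ⁻¹' F) (N := X.isoSpec.inv ⁻¹ᵁ N)
    (hF.preimage X.isoSpec.inv.homeomorph.injective.injOn) (fun q hq => hFN hq)
  have e (x : X) : X.isoSpec.inv (X.toSpecΓ x) = x := X.hom_inv_apply X.isoSpec x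
  refine ⟨h, fun x hx => ?_, fun x hx => ?_⟩
  · rw [← X.toSpecΓ_preimage_basicOpen]
    exact h₁ (show X.isoSpec.inv (X.toSpecΓ x) ∈ F by rwa [e])
  · rw [← X.toSpecΓ_preimage_basicOpen] at hx
    have : X.isoSpec.inv (X.toSpecΓ x) ∈ N := h₂ hx
    rwa [e] at this

namespace LocallyRingedSpace

variable {X Z V : Scheme.{u}} {P : LocallyRingedSpace.{u}} {i : Z ⟶ X} {g : Z ⟶ V}
  {p : X.toLocallyRingedSpace ⟶ P} {j : V.toLocallyRingedSpace ⟶ P}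

/-- Affine open subsets `W ⊆ X` and `U ⊆ V` with `i⁻¹ W = g⁻¹ U`, such that `U` contains a given
point of `V`. -/
lemma exists_isAffineOpen_of_finite [IsAffine X] (i : Z ⟶ X) [IsClosedImmersion i] (g : Z ⟶ V)
    [IsFinite g] (v : V) :
    ∃ (W : X.Opens) (U : V.Opens), IsAffineOpen W ∧ IsAffineOpen U ∧ v ∈ U ∧
      i ⁻¹ᵁ W = g ⁻¹ᵁ U := by
  obtain ⟨U, hU, hvU, -⟩ := exists_isAffineOpen_mem_and_subset (x := v) (U := ⊤) trivial
  have hi : Function.Injective i := i.isClosedEmbedding.injective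
  -- a function `h` on `X` that vanishes on `i(Z ∖ g⁻¹ U)` and at no point of `i(g⁻¹ v)`
  let N : X.Opens := ⟨(i '' (g ⁻¹ᵁ U : Set Z)ᶜ)ᶜ,
    (i.isClosedEmbedding.isClosedMap _ (g ⁻¹ᵁ U).isOpen.isClosed_compl).isOpen_compl⟩
  obtain ⟨h, hF, hN⟩ := Scheme.exists_basicOpen_le_of_finite (F := i '' (g ⁻¹' {v}))
    ((g.finite_preimage_singleton v).image i) (N := N) (by
      rintro _ ⟨z, hz, rfl⟩ ⟨z', hz', e⟩
      rw [hi e] at hz'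
      exact hz' (show g z ∈ U from (show g z = v from hz) ▸ hvU))
  have hle : i ⁻¹ᵁ X.basicOpen h ≤ g ⁻¹ᵁ U := fun z hz => by
    by_contra hz'
    exact hN hz ⟨z, hz', rfl⟩
  -- a neighbourhood `D(u)` of `v` whose preimage in `Z` is contained in that of `D(h)`
  let M : V.Opens := U ⊓ ⟨(g '' (i ⁻¹ᵁ X.basicOpen h : Set Z)ᶜ)ᶜ,
    (g.isClosedMap _ (i ⁻¹ᵁ X.basicOpen h).isOpen.isClosed_compl).isOpen_compl⟩
  have hvM : v ∈ M := by
    refine ⟨hvU, ?_⟩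
    rintro ⟨z, hz, rfl⟩
    exact hz (hF ⟨z, rfl, rfl⟩)
  obtain ⟨u, huM, hvu⟩ := hU.exists_basicOpen_le (V := M) ⟨v, hvM⟩ hvU
  have hD : IsAffineOpen (X.basicOpen h) := (isAffineOpen_top X).basicOpen h
  -- lift the pullback of `u` to `Z` along the closed immersion
  obtain ⟨w, hw⟩ := i.app_surjective _ hD (g.appLE U _ hle u)
  refine ⟨X.basicOpen w, V.basicOpen u, hD.basicOpen w, hU.basicOpen u, hvu, ?_⟩
  rw [Scheme.preimage_basicOpen, hw, Scheme.basicOpen_appLE, inf_eq_right]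
  intro z hz
  by_contra hz'
  exact (huM hz).2 ⟨z, hz', rfl⟩

/-- Every point of the push-out has an open neighbourhood whose preimages in `X` and `V` are both
affine. -/
lemma exists_isAffineOpen_preimageOpens [IsAffine X] [IsClosedImmersion i] [IsFinite g]
    (h : IsPushout i.toLRSHom g.toLRSHom p j) (y : P) :
    ∃ O : Opens P, y ∈ O ∧ IsAffineOpen (preimageOpens p O) ∧
      IsAffineOpen (preimageOpens j O) := by
  have key (v : V) : ∃ O : Opens P, j.base v ∈ O ∧ IsAffineOpen (preimageOpens p O) ∧
      IsAffineOpen (preimageOpens j O) := by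
    obtain ⟨W, U, hW, hU, hvU, hWU⟩ := exists_isAffineOpen_of_finite i g v
    obtain ⟨O, rfl, rfl⟩ := exists_opens_of_isPushout h W U hWU
    exact ⟨O, hvU, hW, hU⟩
  rcases mem_range_of_isPushout h y with ⟨x, rfl⟩ | ⟨v, rfl⟩
  · by_cases hx : x ∈ Set.range i
    · obtain ⟨z, rfl⟩ := hx
      rw [show p.base (i z) = j.base (g z) from
        congrArg (fun f : Z.toLocallyRingedSpace ⟶ P => f.base z) h.w]
      exact key _
    · obtain ⟨W, hW, hxW, hWi⟩ := exists_isAffineOpen_mem_and_subset (x := x)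
        (U := ⟨(Set.range i)ᶜ, i.isClosedEmbedding.isClosed_range.isOpen_compl⟩) hx
      obtain ⟨O, rfl, hO⟩ := exists_opens_of_isPushout h W ⊥ (by
        ext z
        refine ⟨fun hz => (hWi hz ⟨z, rfl⟩).elim, fun hz => hz.elim⟩)
      exact ⟨O, hxW, hW, hO ▸ isAffineOpen_bot V⟩
  · exact key v

end LocallyRingedSpace

end AlgebraicGeometry

end AffineNeighbourhoods

/-! ### Push-outs of schemes along closed immersions and finite morphisms -/

section SchemePushout

open Opposite TopologicalSpace Topology LocallyRingedSpace

namespace AlgebraicGeometry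

namespace Scheme

variable {X Z V Y : Scheme.{u}} {i : Z ⟶ X} {g : Z ⟶ V} {p : X ⟶ Y} {j : V ⟶ Y}

/-- A push-out of schemes in the category of locally ringed spaces, along a closed immersion into an
affine scheme and a finite morphism, as a scheme. -/
def ofIsPushout [IsAffine X] [IsClosedImmersion i] [IsFinite g] {P : LocallyRingedSpace.{u}}
    {p : X.toLocallyRingedSpace ⟶ P} {j : V.toLocallyRingedSpace ⟶ P}
    (h : IsPushout i.toLRSHom g.toLRSHom p j) : Scheme.{u} where
  toLocallyRingedSpace := P
  local_affine y := by
    obtain ⟨O, hy, hW, hU⟩ := exists_isAffineOpen_preimageOpens h y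
    have := isIso_toΓSpec_restrict h hW hU
    exact ⟨⟨O, hy⟩, _, ⟨@asIso _ _ _ _ (P.restrict O.isOpenEmbedding).toΓSpec this⟩⟩

/-- The push-out in the category of locally ringed spaces is a scheme, so it is the push-out in the
category of schemes. -/
lemma isPushout_toLRSHom [IsAffine X] [IsClosedImmersion i] [IsFinite g]
    (h : IsPushout i g p j) :
    IsPushout i.toLRSHom g.toLRSHom p.toLRSHom j.toLRSHom := by
  have hP := IsPushout.of_hasPushout i.toLRSHom g.toLRSHom
  let S := ofIsPushout hP
  let p' : X ⟶ S := ⟨Limits.pushout.inl i.toLRSHom g.toLRSHom⟩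
  let j' : V ⟶ S := ⟨Limits.pushout.inr i.toLRSHom g.toLRSHom⟩
  have hS : IsPushout i g p' j' :=
    IsPushout.of_map Scheme.forgetToLocallyRingedSpace (Scheme.Hom.ext' hP.w) hP
  exact hP.of_iso (Iso.refl _) (Iso.refl _) (Iso.refl _)
    (Scheme.forgetToLocallyRingedSpace.mapIso (hS.isoIsPushout _ _ h)) (by simp) (by simp)
    ((congrArg Scheme.Hom.toLRSHom (IsPushout.inl_isoIsPushout_hom _ _ hS h)).trans
      (Category.id_comp _).symm)
    ((congrArg Scheme.Hom.toLRSHom (IsPushout.inr_isoIsPushout_hom _ _ hS h)).trans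
      (Category.id_comp _).symm)

variable [IsAffine X] [IsClosedImmersion i] [IsFinite g]

lemma isAffineOpen_of_isPushout (h : IsPushout i g p j) {O : Y.Opens}
    (hW : IsAffineOpen (p ⁻¹ᵁ O)) (hU : IsAffineOpen (j ⁻¹ᵁ O)) : IsAffineOpen O := by
  have := isIso_toΓSpec_restrict (isPushout_toLRSHom h) hW hU
  have : IsIso (Scheme.forgetToLocallyRingedSpace.map (O : Scheme).toSpecΓ) := this
  exact ⟨isIso_of_reflects_iso (O : Scheme).toSpecΓ Scheme.forgetToLocallyRingedSpace⟩

/-- The affine open subsets of the push-out whose preimages in `X` and `V` are affine form a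
basis of the topology. -/
lemma exists_isAffineOpen_of_isPushout (h : IsPushout i g p j) (y : Y) (N : Y.Opens)
    (hy : y ∈ N) : ∃ O : Y.Opens, y ∈ O ∧ O ≤ N ∧ IsAffineOpen O ∧ IsAffineOpen (p ⁻¹ᵁ O) ∧
      IsAffineOpen (j ⁻¹ᵁ O) := by
  obtain ⟨O, hyO, hW, hU⟩ := exists_isAffineOpen_preimageOpens (isPushout_toLRSHom h) y
  obtain ⟨f, hfN, hyf⟩ := (isAffineOpen_of_isPushout h hW hU).exists_basicOpen_le ⟨y, hy⟩ hyO
  have hW' : IsAffineOpen (p ⁻¹ᵁ Y.basicOpen f) := by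
    rw [Scheme.preimage_basicOpen]
    exact hW.basicOpen _
  have hU' : IsAffineOpen (j ⁻¹ᵁ Y.basicOpen f) := by
    rw [Scheme.preimage_basicOpen]
    exact hU.basicOpen _
  exact ⟨Y.basicOpen f, hyf, hfN, isAffineOpen_of_isPushout h hW' hU', hW', hU'⟩

lemma isPushout_appLE_of_isPullback {X S Y T : Scheme.{u}} {g : Y ⟶ X} {iY : Y ⟶ T} {iX : X ⟶ S}
    {f : T ⟶ S} (H : IsPullback g iY iX f) {US : S.Opens} {UT : T.Opens} {UX : X.Opens}
    {UY : Y.Opens} (hUS : IsAffineOpen US) (hUT : IsAffineOpen UT) (hUX : IsAffineOpen UX)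
    (hUST : UT ≤ f ⁻¹ᵁ US) (hUSX : UX ≤ iX ⁻¹ᵁ US) (hUY : UY = g ⁻¹ᵁ UX ⊓ iY ⁻¹ᵁ UT) :
    IsPushout (f.appLE US UT hUST) (iX.appLE US UX hUSX)
      (iY.appLE UT UY (hUY.le.trans inf_le_right)) (g.appLE UX UY (hUY.le.trans inf_le_left)) :=
  ((isIso_pushoutSection_iff H hUST hUSX hUY).mp
    (isIso_pushoutSection_of_isAffineOpen H hUST hUSX hUY hUS hUT hUX)).flip

/-- On affine open subsets of the push-outs, a cartesian morphism of spans induces a morphism of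
Milnor squares. -/
lemma isMilnorMap_appLE {X₁ Z₁ V₁ Y₁ X₂ Z₂ V₂ Y₂ : Scheme.{u}}
    {i₁ : Z₁ ⟶ X₁} {g₁ : Z₁ ⟶ V₁} {p₁ : X₁ ⟶ Y₁} {j₁ : V₁ ⟶ Y₁}
    {i₂ : Z₂ ⟶ X₂} {g₂ : Z₂ ⟶ V₂} {p₂ : X₂ ⟶ Y₂} {j₂ : V₂ ⟶ Y₂}
    [IsAffine X₁] [IsAffine X₂] [IsClosedImmersion i₁] [IsClosedImmersion i₂]
    [IsFinite g₁] [IsFinite g₂] (h₁ : IsPushout i₁ g₁ p₁ j₁) (h₂ : IsPushout i₂ g₂ p₂ j₂)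
    {x : X₁ ⟶ X₂} {z : Z₁ ⟶ Z₂} {v : V₁ ⟶ V₂} {f : Y₁ ⟶ Y₂}
    (hV : IsPullback g₁ z v g₂) (hX : IsPullback i₁ z x i₂)
    (hp : p₁ ≫ f = x ≫ p₂) (hj : j₁ ≫ f = v ≫ j₂) {O₁ : Y₁.Opens} {O₂ : Y₂.Opens}
    (e : O₁ ≤ f ⁻¹ᵁ O₂) (hW₁ : IsAffineOpen (p₁ ⁻¹ᵁ O₁)) (hU₁ : IsAffineOpen (j₁ ⁻¹ᵁ O₁))
    (hW₂ : IsAffineOpen (p₂ ⁻¹ᵁ O₂)) (hU₂ : IsAffineOpen (j₂ ⁻¹ᵁ O₂))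
    (ex : p₁ ⁻¹ᵁ O₁ ≤ x ⁻¹ᵁ p₂ ⁻¹ᵁ O₂) (ev : j₁ ⁻¹ᵁ O₁ ≤ v ⁻¹ᵁ j₂ ⁻¹ᵁ O₂)
    (ez : i₁ ⁻¹ᵁ p₁ ⁻¹ᵁ O₁ ≤ z ⁻¹ᵁ i₂ ⁻¹ᵁ p₂ ⁻¹ᵁ O₂)
    (e₁ : i₁ ⁻¹ᵁ p₁ ⁻¹ᵁ O₁ = g₁ ⁻¹ᵁ j₁ ⁻¹ᵁ O₁) (e₂ : i₂ ⁻¹ᵁ p₂ ⁻¹ᵁ O₂ = g₂ ⁻¹ᵁ j₂ ⁻¹ᵁ O₂) :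
    IsMilnorMap (p₁.app O₁) (j₁.app O₁) (i₁.app (p₁ ⁻¹ᵁ O₁))
      (g₁.appLE (j₁ ⁻¹ᵁ O₁) (i₁ ⁻¹ᵁ p₁ ⁻¹ᵁ O₁) e₁.le)
      (p₂.app O₂) (j₂.app O₂) (i₂.app (p₂ ⁻¹ᵁ O₂))
      (g₂.appLE (j₂ ⁻¹ᵁ O₂) (i₂ ⁻¹ᵁ p₂ ⁻¹ᵁ O₂) e₂.le)
      (f.appLE O₂ O₁ e) (x.appLE (p₂ ⁻¹ᵁ O₂) (p₁ ⁻¹ᵁ O₁) ex)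
      (v.appLE (j₂ ⁻¹ᵁ O₂) (j₁ ⁻¹ᵁ O₁) ev)
      (z.appLE (i₂ ⁻¹ᵁ p₂ ⁻¹ᵁ O₂) (i₁ ⁻¹ᵁ p₁ ⁻¹ᵁ O₁) ez) where
  isPullback₁ := isPullback_c_app (isPushout_toLRSHom h₁) O₁
  isPullback₂ := isPullback_c_app (isPushout_toLRSHom h₂) O₂
  surjective := i₂.app_surjective _ hW₂
  wA := by
    rw [Scheme.Hom.app_eq_appLE, Scheme.Hom.app_eq_appLE, Scheme.Hom.appLE_comp_appLE,
      Scheme.Hom.appLE_comp_appLE]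
    simp only [hp]
  wB := by
    rw [Scheme.Hom.app_eq_appLE, Scheme.Hom.app_eq_appLE, Scheme.Hom.appLE_comp_appLE,
      Scheme.Hom.appLE_comp_appLE]
    simp only [hj]
  isPushout_left := by
    rw [i₁.app_eq_appLE, i₂.app_eq_appLE]
    exact isPushout_appLE_of_isPullback hX hW₂ (hW₂.preimage i₂) hW₁ _ ex
      (inf_eq_left.mpr ez).symm
  isPushout_right := isPushout_appLE_of_isPullback hV hU₂ (hW₂.preimage i₂) hU₁ _ ev
    (by rw [← e₁]; exact (inf_eq_left.mpr ez).symm)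

/-- A local property `P` that descends along morphisms of Milnor squares passes from the components
`x` and `v` of a cartesian morphism of spans to the induced morphism of push-outs. -/
lemma of_isPushout_of_isMilnorMap {P : MorphismProperty Scheme.{u}}
    {Q : ∀ {R S : Type u} [CommRing R] [CommRing S], (R →+* S) → Prop} [HasRingHomProperty P Q]
    (hQ' : RingHom.StableUnderCompositionWithLocalizationAwaySource Q)
    (hQ : ∀ {R₁ A₁ B₁ C₁ R₂ A₂ B₂ C₂ : CommRingCat.{u}}
      {rA₁ : R₁ ⟶ A₁} {rB₁ : R₁ ⟶ B₁} {α₁ : A₁ ⟶ C₁} {β₁ : B₁ ⟶ C₁}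
      {rA₂ : R₂ ⟶ A₂} {rB₂ : R₂ ⟶ B₂} {α₂ : A₂ ⟶ C₂} {β₂ : B₂ ⟶ C₂}
      {φR : R₂ ⟶ R₁} {φA : A₂ ⟶ A₁} {φB : B₂ ⟶ B₁} {φC : C₂ ⟶ C₁},
      IsMilnorMap rA₁ rB₁ α₁ β₁ rA₂ rB₂ α₂ β₂ φR φA φB φC → Q φA.hom → Q φB.hom → Q φR.hom)
    {X₁ Z₁ V₁ Y₁ X₂ Z₂ V₂ Y₂ : Scheme.{u}}
    {i₁ : Z₁ ⟶ X₁} {g₁ : Z₁ ⟶ V₁} {p₁ : X₁ ⟶ Y₁} {j₁ : V₁ ⟶ Y₁}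
    {i₂ : Z₂ ⟶ X₂} {g₂ : Z₂ ⟶ V₂} {p₂ : X₂ ⟶ Y₂} {j₂ : V₂ ⟶ Y₂}
    [IsAffine X₁] [IsAffine X₂] [IsClosedImmersion i₁] [IsClosedImmersion i₂]
    [IsFinite g₁] [IsFinite g₂] (h₁ : IsPushout i₁ g₁ p₁ j₁) (h₂ : IsPushout i₂ g₂ p₂ j₂)
    {x : X₁ ⟶ X₂} {z : Z₁ ⟶ Z₂} {v : V₁ ⟶ V₂} {f : Y₁ ⟶ Y₂}
    (hV : IsPullback g₁ z v g₂) (hX : IsPullback i₁ z x i₂)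
    (hp : p₁ ≫ f = x ≫ p₂) (hj : j₁ ≫ f = v ≫ j₂) (hx : P x) (hv : P v) : P f := by
  rw [HasRingHomProperty.iff_exists_appLE (P := P) (Q := Q) hQ']
  intro y
  obtain ⟨O₂, hy₂, -, hO₂, hW₂, hU₂⟩ := exists_isAffineOpen_of_isPushout h₂ (f y) ⊤ trivial
  obtain ⟨O₁, hy₁, e, hO₁, hW₁, hU₁⟩ := exists_isAffineOpen_of_isPushout h₁ y (f ⁻¹ᵁ O₂) hy₂
  have ex : p₁ ⁻¹ᵁ O₁ ≤ x ⁻¹ᵁ p₂ ⁻¹ᵁ O₂ := by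
    rw [← Scheme.Hom.comp_preimage, ← hp]
    exact fun t ht => e ht
  have ev : j₁ ⁻¹ᵁ O₁ ≤ v ⁻¹ᵁ j₂ ⁻¹ᵁ O₂ := by
    rw [← Scheme.Hom.comp_preimage, ← hj]
    exact fun t ht => e ht
  have ez : i₁ ⁻¹ᵁ p₁ ⁻¹ᵁ O₁ ≤ z ⁻¹ᵁ i₂ ⁻¹ᵁ p₂ ⁻¹ᵁ O₂ := by
    rw [← Scheme.Hom.comp_preimage z, ← hX.w]
    exact fun t ht => ex ht
  have hM := isMilnorMap_appLE h₁ h₂ hV hX hp hj e hW₁ hU₁ hW₂ hU₂ ex ev ez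
    (preimage_preimageOpens_eq (isPushout_toLRSHom h₁) O₁)
    (preimage_preimageOpens_eq (isPushout_toLRSHom h₂) O₂)
  exact ⟨⟨O₂, hO₂⟩, ⟨O₁, hO₁⟩, hy₁, e, hQ hM
    (HasRingHomProperty.appLE P x hx ⟨_, hW₂⟩ ⟨_, hW₁⟩ ex)
    (HasRingHomProperty.appLE P v hv ⟨_, hU₂⟩ ⟨_, hU₁⟩ ev)⟩

end Scheme

end AlgebraicGeometry

end SchemePushout

theorem mainTheorem9 (A : CommRingCat.{u})
    (X₁ Z₁ V₁ Y₁ X₂ Z₂ V₂ Y₂ : Over (Spec A))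
    (i₁ : Z₁ ⟶ X₁) (g₁ : Z₁ ⟶ V₁) (p₁ : X₁ ⟶ Y₁) (j₁ : V₁ ⟶ Y₁)
    (i₂ : Z₂ ⟶ X₂) (g₂ : Z₂ ⟶ V₂) (p₂ : X₂ ⟶ Y₂) (j₂ : V₂ ⟶ Y₂)
    [IsAffine X₁.left] [IsNoetherian X₁.left] [IsAffine X₂.left] [IsNoetherian X₂.left]
    [IsClosedImmersion i₁.left] [IsClosedImmersion i₂.left]
    [IsFinite g₁.left] [Surjective g₁.left] [IsFinite g₂.left] [Surjective g₂.left]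
    (h₁ : IsPushout i₁ g₁ p₁ j₁) (h₂ : IsPushout i₂ g₂ p₂ j₂)
    (x : X₁ ⟶ X₂) (z : Z₁ ⟶ Z₂) (v : V₁ ⟶ V₂)
    (hV : IsPullback g₁ z v g₂) (hX : IsPullback i₁ z x i₂) :
    (Flat v.left → Flat z.left → Flat x.left →
      Flat (inducedPushoutMap h₁ h₂ hX.w hV.w).left) ∧
    (Smooth v.left → Smooth z.left → Smooth x.left →
      Smooth (inducedPushoutMap h₁ h₂ hX.w hV.w).left) := by
  have hp : p₁.left ≫ (inducedPushoutMap h₁ h₂ hX.w hV.w).left = x.left ≫ p₂.left := by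
    rw [← Over.comp_left, ← Over.comp_left, inducedPushoutMap, h₁.inl_desc]
  have hj : j₁.left ≫ (inducedPushoutMap h₁ h₂ hX.w hV.w).left = v.left ≫ j₂.left := by
    rw [← Over.comp_left, ← Over.comp_left, inducedPushoutMap, h₁.inr_desc]
  have h₁' : IsPushout i₁.left g₁.left p₁.left j₁.left := h₁.map (Over.forget _)
  have h₂' : IsPushout i₂.left g₂.left p₂.left j₂.left := h₂.map (Over.forget _)
  have hV' : IsPullback g₁.left z.left v.left g₂.left := hV.map (Over.forget _)
  have hX' : IsPullback i₁.left z.left x.left i₂.left := hX.map (Over.forget _)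
  refine ⟨fun hv _ hx => ?_, fun hv _ hx => ?_⟩
  · exact Scheme.of_isPushout_of_isMilnorMap
      (RingHom.Flat.stableUnderComposition.stableUnderCompositionWithLocalizationAway
        RingHom.Flat.holdsForLocalizationAway).1
      IsMilnorMap.flat h₁' h₂' hV' hX' hp hj hx hv
  · exact Scheme.of_isPushout_of_isMilnorMap
      (RingHom.Smooth.stableUnderComposition.stableUnderCompositionWithLocalizationAway
        RingHom.Smooth.holdsForLocalizationAway).1
      IsMilnorMap.smooth h₁' h₂' hV' hX' hp hj hx hv
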